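/- Let $\nu \in \mathbb R$, $\sigma^2 \ge 0$ and let $m \ge 1$ be an integer. Let $\mu \sim \mathcal N(\nu,\sigma^2)$ and let $Y_1,\dots,Y_m$ be random variables that are, conditionally on $\mu$, independent with law $\mathcal N(\mu,1)$. The finite-horizon Gittins index is $$\gamma(\nu,\sigma^2,m) = \max\Big\{\gamma\in\mathbb R : \sup_{1\le\tau\le m} \mathbb E[(\mu-\gamma)\tau] \ge 0\Big\},$$ where the supremum is over the stopping times $\tau$ of the filtration generated by $Y_1,\dots,Y_m$ with $1\le\tau\le m$. Write $\log_+(x)=\max\{1,\log x\}$ (with $\log_+(0)=1$). The maximum exists, and there is a universal constant $c>0$ such that, for all $\nu \in \mathbb R$, $\sigma^2\ge 0$ and $m\ge 1$, there is a $\beta\ge 1$ with $$\gamma(\nu,\sigma^2,m)=\nu+\sqrt{2\sigma^2\log\beta}$$ and $$c\,\min\left\{\frac{m}{\log_+^{3/2}(m)},\ \frac{m\sigma^2}{\log_+^{1/2}(m\sigma^2)}\right\}\ \le\ \beta\ \le\ \frac{m}{\log^{3/2}(m)},$$ where for $m=1$ the right-hand side is read as $+\infty$. If $\sigma^2>0$,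 every $\beta\ge1$ with $\gamma(\nu,\sigma^2,m)=\nu+\sqrt{2\sigma^2\log\beta}$ satisfies these bounds. Consequently, for all fixed $\nu\in\mathbb R$ and $\sigma^2>0$, $$\exp\left(\left(\frac{\gamma(\nu,\sigma^2,m)-\nu}{\sqrt{2\sigma^2}}\right)^2\right)=\Theta\left(\frac{m}{\log^{3/2} m}\right)\qquad (m\to\infty).$$ -/

import Mathlib

open MeasureTheory ProbabilityTheory Filter Asymptotics
open scoped NNReal

namespace Gittins

/-- `log₊ x = max {1, log x}`. -/
noncomputable def logPlus (x : ℝ) : ℝ := max 1 (Real.log x)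

/-- The conditional law of the rewards `(Y₁, …, Yₘ)` given that the mean of the arm is `θ`:
they are independent with law `N(θ, 1)`. -/
noncomputable def rewardKernel (m : ℕ) : Kernel ℝ (Fin m → ℝ) where
  toFun θ := Measure.pi fun _ : Fin m => gaussianReal θ 1
  measurable' := by
    refine Measurable.measure_of_isPiSystem_of_isProbabilityMeasure
      generateFrom_pi.symm isPiSystem_pi ?_
    rintro _ ⟨s, hs, rfl⟩
    simp only [Measure.pi_pi]
    refine Finset.measurable_prod _ fun i _ => ?_
    have h : Measurable fun θ : ℝ => gaussianReal θ 1 :=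
      measurable_gaussianReal.comp (measurable_id.prodMk measurable_const)
    exact Measure.measurable_measure.1 h (s i) (hs i (Set.mem_univ i))

/-- The joint law of `(μ, (Y₁, …, Yₘ))`, where `μ ∼ N(ν, v)` and, given `μ`, the rewards are
independent with law `N(μ, 1)`. On the sample space `ℝ × (Fin m → ℝ)` the mean is
`μ ω = ω.1` and the reward `Yₛ` is `ω.2 ⟨s - 1, _⟩`. -/
noncomputable def jointLaw (ν : ℝ) (v : ℝ≥0) (m : ℕ) : Measure (ℝ × (Fin m → ℝ)) :=
  (gaussianReal ν v).compProd (rewardKernel m)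

/-- The filtration generated by the rewards: at time `t` it is the σ-algebra generated by
`Y₁, …, Yₜ`, that is, by the coordinates of `ω.2` with (zero-based) index `< t`. -/
def rewardFiltration (m : ℕ) :
    Filtration ℕ (inferInstance : MeasurableSpace (ℝ × (Fin m → ℝ))) where
  seq t := ⨆ s : Fin m, ⨆ _ : (s : ℕ) < t,
    MeasurableSpace.comap (fun ω : ℝ × (Fin m → ℝ) => ω.2 s) inferInstance
  mono' := fun _ _ h => iSup_mono fun _ => iSup_mono' fun hs => ⟨hs.trans_le h, le_rfl⟩
  le' := fun _ => iSup_le fun s => iSup_le fun _ =>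
    Measurable.comap_le ((measurable_pi_apply s).comp measurable_snd)

/-- The stopping times `1 ≤ τ ≤ m` of the filtration generated by the rewards. -/
def stoppingTimes (m : ℕ) : Set (ℝ × (Fin m → ℝ) → ℕ) :=
  {τ | IsStoppingTime (rewardFiltration m) (fun ω => ((τ ω : ℕ) : WithTop ℕ)) ∧
    ∀ ω, 1 ≤ τ ω ∧ τ ω ≤ m}

/-- `sup_{1 ≤ τ ≤ m} E[(μ - γ) τ]`. For `m ≥ 1` this is the supremum of a nonempty set of reals
that is bounded by `m E|μ - γ|`. -/
noncomputable def stoppingValue (ν : ℝ) (v : ℝ≥0) (m : ℕ) (γ : ℝ) : ℝ :=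
  sSup ((fun τ : ℝ × (Fin m → ℝ) → ℕ => ∫ ω, (ω.1 - γ) * (τ ω : ℝ) ∂(jointLaw ν v m)) ''
    stoppingTimes m)

/-- The set `{γ : sup_{1 ≤ τ ≤ m} E[(μ - γ) τ] ≥ 0}`. -/
def indexSet (ν : ℝ) (v : ℝ≥0) (m : ℕ) : Set ℝ := {γ | 0 ≤ stoppingValue ν v m γ}

/-- The finite-horizon Gittins index `γ(ν, v, m)` of an arm with posterior mean `ν`, posterior
variance `v` and `m` remaining rounds: the largest element of `indexSet ν v m`. -/
noncomputable def gittinsIndex (ν : ℝ) (v : ℝ≥0) (m : ℕ) : ℝ := sSup (indexSet ν v m)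

/-- The two bounds on `β` for variance `v`, horizon `m` and constant `c`. At `m = 1` the quotient
`m / log^{3/2} m` of the upper bound reads `1 / 0 = ∞`, so the upper bound is only
a condition when `m ≥ 2`. -/
def BetaBounds (c : ℝ) (v : ℝ≥0) (m : ℕ) (β : ℝ) : Prop :=
  c * min ((m : ℝ) / logPlus m ^ (3 / 2 : ℝ))
      ((m : ℝ) * (v : ℝ) / logPlus ((m : ℝ) * (v : ℝ)) ^ (1 / 2 : ℝ)) ≤ β ∧
    (2 ≤ m → β ≤ (m : ℝ) / Real.log m ^ (3 / 2 : ℝ))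

end Gittins

namespace Gittins

/-! Write γ = ν + σx with σ > 0. Everything reduces to deciding for which x the value of the
stopping problem is nonnegative.

Upper bound. Revealing μ after the first round can only help, so the value is at most σ((m - 1) E(Z
- x)⁺ - x) (`integral_reward_le`). Since E(Z - x)⁺ is at most the Gaussian density at x divided by
x², nonnegativity forces x³ exp(x²/2) √(2π) ≤ m (`cube_mul_exp_le_of_mem_indexSet`). Solving for
exp(x²/2) yields m / log^{3/2} m (`exp_le_div_log_rpow`).

Lower bound. An explicit rule tests the arm at times t₀·16^j, j ≤ J = ⌈x⌉, with t₀ about 1/(x²σ²),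
abandons it when the empirical mean falls j + 2 standard errors below γ, and otherwise plays to the
horizon. An arm with μ ≥ γ fails some test with probability at most 1/2, so half of the gain m σ E(Z
- x)⁺ survives. Bad arms pass test j with probability exponentially small in the shortfall γ - μ, so
the loss before the last test is of order σ t₀ x, and the loss after it is at most half of the lower
bound obtained for the gain. Hence γ is admissible once m is at least a constant times exp(x²/2) x³
(1 + 1/(x²σ²)) (`mem_indexSet_of_horizon_ge`). The two summands produce the two entries of the
minimum (`horizon_ge_of_exp_eq`).

The maximum exists because the value is Lipschitz in γ and the admissible set is bounded. For fixed
σ > 0 the minimum is of order m / log^{3/2} m, which gives the asymptotic statement. -/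

/-- The expected excess `E (Z - x)⁺` of a standard Gaussian variable over the level `x`. -/
noncomputable def expectedExcess (x : ℝ) : ℝ := ∫ z, max (z - x) 0 ∂(gaussianReal 0 1)

/-! ### Gaussian integrals: excess and shortfall -/

lemma integrable_id_gaussianReal (ν : ℝ) (v : ℝ≥0) :
    Integrable (fun θ : ℝ => θ) (gaussianReal ν v) :=
  (memLp_id_gaussianReal 1).integrable le_rfl

lemma integrable_max_sub_gaussianReal (ν : ℝ) (v : ℝ≥0) (a : ℝ) :
    Integrable (fun θ : ℝ => max (θ - a) 0) (gaussianReal ν v) :=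
  ((integrable_id_gaussianReal ν v).sub (integrable_const a)).pos_part

lemma integrable_max_const_sub_gaussianReal (ν : ℝ) (v : ℝ≥0) (a : ℝ) :
    Integrable (fun θ : ℝ => max (a - θ) 0) (gaussianReal ν v) :=
  ((integrable_const a).sub (integrable_id_gaussianReal ν v)).pos_part

lemma integral_exp_mul_gaussianReal (μ k : ℝ) :
    ∫ z, Real.exp (k * z) ∂(gaussianReal μ 1) = Real.exp (μ * k + k ^ 2 / 2) := by
  have h := congrFun (mgf_id_gaussianReal (μ := μ) (v := 1)) k
  simpa [mgf] using h

/-- Every Gaussian law is an affine image of the standard one. -/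
lemma gaussianReal_eq_map (ν : ℝ) (v : ℝ≥0) :
    gaussianReal ν v = (gaussianReal 0 1).map (fun z => ν + Real.sqrt v * z) := by
  have h : (fun z : ℝ => ν + Real.sqrt v * z) = (fun y => ν + y) ∘ fun z => Real.sqrt v * z := rfl
  rw [h, ← Measure.map_map (by fun_prop) (by fun_prop), gaussianReal_map_const_mul,
    gaussianReal_map_const_add]
  congr 1
  · simp
  · ext; simp

lemma integral_gaussianReal_eq (ν : ℝ) (v : ℝ≥0) {f : ℝ → ℝ} (hf : Measurable f) :
    ∫ θ, f θ ∂(gaussianReal ν v) = ∫ z, f (ν + Real.sqrt v * z) ∂(gaussianReal 0 1) := by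
  rw [gaussianReal_eq_map ν v, integral_map (by fun_prop) hf.aestronglyMeasurable]

lemma expectedExcess_eq (x : ℝ) :
    expectedExcess x =
      ∫ u : ℝ, ((Real.sqrt (2 * Real.pi))⁻¹ * Real.exp (-(u + x) ^ 2 / 2)) * max u 0 := by
  unfold expectedExcess
  rw [integral_gaussianReal_eq_integral_smul one_ne_zero, ← integral_add_right_eq_self _ x]
  simp [gaussianPDFReal]

lemma integrable_shifted_density_mul (x : ℝ) : Integrable fun u : ℝ =>
    ((Real.sqrt (2 * Real.pi))⁻¹ * Real.exp (-(u + x) ^ 2 / 2)) * max u 0 := by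
  have h := integrable_max_sub_gaussianReal 0 1 x
  rw [gaussianReal_of_var_ne_zero _ one_ne_zero,
    integrable_withDensity_iff_integrable_smul' (measurable_gaussianPDF 0 1)
      (ae_of_all _ fun _ => gaussianPDF_lt_top)] at h
  simpa [toReal_gaussianPDF, gaussianPDFReal] using h.comp_add_right x

/-- Dropping u² from (u + x)² leaves the integral of u exp(-xu) over u > 0, which is 1/x². -/
lemma expectedExcess_le {x : ℝ} (hx : 0 < x) :
    expectedExcess x ≤ (Real.sqrt (2 * Real.pi))⁻¹ * Real.exp (-x ^ 2 / 2) / x ^ 2 := by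
  set C := (Real.sqrt (2 * Real.pi))⁻¹ * Real.exp (-x ^ 2 / 2) with hC
  have hint : IntegrableOn (fun u : ℝ => C * (u * Real.exp (-(x * u)))) (Set.Ioi 0) := by
    have := integrableOn_rpow_mul_exp_neg_mul_rpow (s := 1) (p := 1) (by norm_num) one_pos hx
    simpa [IntegrableOn] using this.const_mul C
  have hval : ∫ u in Set.Ioi (0 : ℝ), C * (u * Real.exp (-(x * u))) = C / x ^ 2 := by
    have := Real.integral_rpow_mul_exp_neg_mul_Ioi (a := 2) (r := x) two_pos hx
    have h1 : (2 : ℝ) - 1 = 1 := by norm_num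
    simp only [h1, Real.rpow_one, Real.Gamma_two, mul_one, Real.rpow_two] at this
    rw [integral_const_mul, this]
    field_simp
  rw [expectedExcess_eq, ← hval, ← integral_indicator measurableSet_Ioi]
  refine integral_mono_of_nonneg (ae_of_all _ fun u => by positivity)
    (hint.integrable_indicator measurableSet_Ioi) (ae_of_all _ fun u => ?_)
  by_cases hu : 0 < u
  · rw [Set.indicator_of_mem (Set.mem_Ioi.2 hu)]
    simp only [max_eq_left hu.le]
    have : Real.exp (-(u + x) ^ 2 / 2) ≤ Real.exp (-x ^ 2 / 2) * Real.exp (-(x * u)) := by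
      rw [← Real.exp_add]
      exact Real.exp_le_exp.2 (by nlinarith [sq_nonneg u])
    calc _ ≤ (Real.sqrt (2 * Real.pi))⁻¹ *
            (Real.exp (-x ^ 2 / 2) * Real.exp (-(x * u))) * u := by gcongr
      _ = _ := by rw [hC]; ring
  · rw [Set.indicator_of_notMem (by simpa using hu)]
    simp [max_eq_right (not_lt.1 hu)]

/-- On 0 < u ≤ 1/x the exponent (u + x)²/2 exceeds x²/2 by at most 3/2; the rest of the integral is
discarded. -/
lemma le_expectedExcess {x : ℝ} (hx : 1 ≤ x) :
    (Real.sqrt (2 * Real.pi))⁻¹ * Real.exp (-x ^ 2 / 2) * Real.exp (-3 / 2) / (2 * x ^ 2) ≤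
      expectedExcess x := by
  have hx0 : 0 < x := by linarith
  set C := (Real.sqrt (2 * Real.pi))⁻¹ * Real.exp (-x ^ 2 / 2) * Real.exp (-3 / 2) with hC
  have hval : ∫ u in Set.Ioc (0 : ℝ) x⁻¹, C * u = C / (2 * x ^ 2) := by
    rw [← intervalIntegral.integral_of_le (by positivity), intervalIntegral.integral_const_mul,
      integral_id]
    field_simp
    ring
  rw [expectedExcess_eq, ← hval, ← integral_indicator measurableSet_Ioc]
  refine integral_mono_of_nonneg (ae_of_all _ fun u => ?_) (integrable_shifted_density_mul x)
    (ae_of_all _ fun u => ?_)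
  · exact Set.indicator_nonneg (fun u hu => mul_nonneg (by positivity) hu.1.le) u
  · by_cases hu : u ∈ Set.Ioc (0 : ℝ) x⁻¹
    · rw [Set.indicator_of_mem hu]
      have hu1 : u * x ≤ 1 := by
        have := mul_le_mul_of_nonneg_right hu.2 hx0.le
        rwa [inv_mul_cancel₀ hx0.ne'] at this
      have hu2 : u ≤ 1 := by nlinarith [hu.1]
      simp only [max_eq_left hu.1.le]
      have h3 : Real.exp (-x ^ 2 / 2) * Real.exp (-3 / 2) ≤ Real.exp (-(u + x) ^ 2 / 2) := by
        rw [← Real.exp_add]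
        exact Real.exp_le_exp.2 (by nlinarith [hu.1])
      rw [hC, mul_assoc (Real.sqrt (2 * Real.pi))⁻¹]
      have := hu.1.le
      gcongr
    · rw [Set.indicator_of_notMem hu]
      positivity

/-- The linear factor is absorbed at the price k in the exponential rate, so that Gaussian integrals
become moment generating functions. -/
lemma max_zero_mul_exp_le {k : ℝ} (hk : 0 < k) (l u : ℝ) :
    max u 0 * Real.exp (-(l * u)) ≤ k⁻¹ * Real.exp (-((l - k) * u)) := by
  have h1 : max u 0 ≤ k⁻¹ * Real.exp (k * u) := by
    refine max_le ?_ (by positivity)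
    rw [← div_eq_inv_mul, le_div_iff₀ hk]
    linarith [Real.add_one_le_exp (k * u)]
  calc _ ≤ k⁻¹ * Real.exp (k * u) * Real.exp (-(l * u)) := by gcongr
    _ = _ := by rw [mul_assoc, ← Real.exp_add]; ring_nf

lemma exp_affine_eq (r x z : ℝ) :
    Real.exp (-(r * (x - z))) = Real.exp (-(r * x)) * Real.exp (r * z) := by
  rw [← Real.exp_add]; ring_nf

/-- Exponentially damped expected shortfall below the level `x`. -/
lemma integral_shortfall_mul_exp_le {k : ℝ} (hk : 0 < k) (l x : ℝ) :
    ∫ z, max (x - z) 0 * Real.exp (-(l * (x - z))) ∂(gaussianReal 0 1) ≤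
      k⁻¹ * Real.exp (-((l - k) * x) + (l - k) ^ 2 / 2) := by
  have hI : Integrable (fun z => k⁻¹ * Real.exp (-((l - k) * (x - z)))) (gaussianReal 0 1) := by
    simp_rw [exp_affine_eq]
    exact ((integrable_exp_mul_gaussianReal _).const_mul _).const_mul _
  refine (integral_mono_of_nonneg (ae_of_all _ fun z => by positivity) hI
    (ae_of_all _ fun z => max_zero_mul_exp_le hk l (x - z))).trans_eq ?_
  simp_rw [exp_affine_eq, integral_const_mul, integral_exp_mul_gaussianReal]
  rw [← Real.exp_add]
  ring_nf

lemma integrable_shortfall_mul_exp (l x : ℝ) :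
    Integrable (fun z => max (x - z) 0 * Real.exp (-(l * (x - z)))) (gaussianReal 0 1) := by
  have hI : Integrable (fun z => (1 : ℝ)⁻¹ * Real.exp (-((l - 1) * (x - z)))) (gaussianReal 0 1) := by
    simp_rw [exp_affine_eq]
    exact ((integrable_exp_mul_gaussianReal _).const_mul _).const_mul _
  refine hI.mono' (Measurable.aestronglyMeasurable (by fun_prop)) (ae_of_all _ fun z => ?_)
  rw [Real.norm_of_nonneg (by positivity)]
  exact max_zero_mul_exp_le one_pos l (x - z)

lemma integral_shortfall_le {x : ℝ} (hx : 1 ≤ x) :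
    ∫ z, max (x - z) 0 ∂(gaussianReal 0 1) ≤ 3 * x := by
  have hI : Integrable (fun z => x + Real.exp (-1 * z)) (gaussianReal 0 1) :=
    (integrable_const x).add (integrable_exp_mul_gaussianReal _)
  refine (integral_mono_of_nonneg (ae_of_all _ fun z => le_max_right _ _) hI
    (ae_of_all _ fun z => ?_)).trans ?_
  · refine max_le ?_ (by positivity)
    linarith [Real.add_one_le_exp (-1 * z)]
  · rw [integral_add (integrable_const x) (integrable_exp_mul_gaussianReal _),
      integral_exp_mul_gaussianReal]
    have : Real.exp (0 * -1 + (-1) ^ 2 / 2) ≤ 2 := by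
      have h := Real.exp_one_lt_d9
      have h2 : Real.exp (0 * -1 + (-1) ^ 2 / 2) ^ 2 = Real.exp 1 := by
        rw [← Real.exp_nat_mul]; norm_num
      nlinarith [Real.exp_pos (0 * -1 + (-1) ^ 2 / 2)]
    simp only [integral_const, probReal_univ, one_smul]
    linarith

/-! ### The joint law of the mean and the rewards -/

instance isMarkovKernel_rewardKernel (m : ℕ) : IsMarkovKernel (rewardKernel m) :=
  ⟨fun θ => by
    change IsProbabilityMeasure (Measure.pi fun _ : Fin m => gaussianReal θ 1)
    infer_instance⟩

instance isProbabilityMeasure_jointLaw (ν : ℝ) (v : ℝ≥0) (m : ℕ) :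
    IsProbabilityMeasure (jointLaw ν v m) := by
  unfold jointLaw; infer_instance

section JointLaw

variable {ν : ℝ} {v : ℝ≥0} {m : ℕ} {h : ℝ → ℝ}

lemma map_fst_jointLaw : (jointLaw ν v m).map Prod.fst = gaussianReal ν v :=
  Measure.fst_compProd _ _

lemma integrable_comp_fst_jointLaw (hh : Integrable h (gaussianReal ν v)) :
    Integrable (fun ω => h ω.1) (jointLaw ν v m) := by
  rw [← map_fst_jointLaw (m := m)] at hh
  exact hh.comp_measurable measurable_fst

lemma integral_comp_fst_jointLaw (hh : Measurable h) :
    ∫ ω, h ω.1 ∂(jointLaw ν v m) = ∫ θ, h θ ∂(gaussianReal ν v) := by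
  rw [← map_fst_jointLaw (m := m),
    integral_map measurable_fst.aemeasurable hh.aestronglyMeasurable]

lemma integrable_mul_indicator_jointLaw (hh : Integrable h (gaussianReal ν v))
    {E : Set (Fin m → ℝ)} (hE : MeasurableSet E) :
    Integrable (fun ω => h ω.1 * E.indicator 1 ω.2) (jointLaw ν v m) := by
  refine (integrable_comp_fst_jointLaw hh).mul_bdd (c := 1) ?_ (ae_of_all _ fun ω => ?_)
  · exact ((measurable_one.indicator hE).comp measurable_snd).aestronglyMeasurable
  · by_cases hω : ω.2 ∈ E <;> simp [hω]

lemma integral_mul_indicator_jointLaw (hh : Integrable h (gaussianReal ν v))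
    {E : Set (Fin m → ℝ)} (hE : MeasurableSet E) :
    ∫ ω, h ω.1 * E.indicator 1 ω.2 ∂(jointLaw ν v m) =
      ∫ θ, h θ * (rewardKernel m θ).real E ∂(gaussianReal ν v) := by
  have := integrable_mul_indicator_jointLaw (m := m) hh hE
  unfold jointLaw at this ⊢
  rw [Measure.integral_compProd this]
  simp only [integral_const_mul, integral_indicator_one hE]

end JointLaw

/-! ### Chernoff bounds for the tests -/

/-- The sum of the first `t` rewards. -/
def partialSum {m : ℕ} (t : ℕ) (y : Fin m → ℝ) : ℝ :=
  ∑ i ∈ Finset.univ.filter (fun i : Fin m => (i : ℕ) < t), y i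

lemma measurable_partialSum {m : ℕ} (t : ℕ) :
    Measurable (partialSum t : (Fin m → ℝ) → ℝ) := by
  unfold partialSum; fun_prop

lemma exp_mul_partialSum {m : ℕ} (t : ℕ) (l : ℝ) (y : Fin m → ℝ) :
    Real.exp (l * partialSum t y) =
      ∏ i : Fin m, (if (i : ℕ) < t then Real.exp (l * y i) else 1) := by
  unfold partialSum
  rw [Finset.mul_sum, Real.exp_sum, Finset.prod_filter]

lemma integrable_exp_mul_partialSum (m t : ℕ) (θ l : ℝ) :
    Integrable (fun y => Real.exp (l * partialSum t y)) (rewardKernel m θ) := by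
  simp_rw [exp_mul_partialSum]
  refine Integrable.fintype_prod (μ := fun _ : Fin m => gaussianReal θ 1)
    (f := fun (i : Fin m) z => if (i : ℕ) < t then Real.exp (l * z) else 1) fun i => ?_
  split_ifs
  · exact integrable_exp_mul_gaussianReal l
  · exact integrable_const 1

lemma mgf_partialSum {m t : ℕ} (ht : t ≤ m) (θ l : ℝ) :
    mgf (partialSum t) (rewardKernel m θ) l = Real.exp (t * (θ * l + l ^ 2 / 2)) := by
  have hcard : (Finset.univ.filter (fun i : Fin m => (i : ℕ) < t)).card = t := by
    rw [Fin.card_filter_val_lt, min_eq_right ht]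
  unfold mgf
  simp_rw [exp_mul_partialSum]
  change ∫ y, _ ∂(Measure.pi fun _ : Fin m => gaussianReal θ 1) = _
  rw [integral_fintype_prod_eq_prod (fun (i : Fin m) z =>
    if (i : ℕ) < t then Real.exp (l * z) else 1)]
  have : ∀ i : Fin m, ∫ z, (if (i : ℕ) < t then Real.exp (l * z) else 1) ∂(gaussianReal θ 1) =
      if (i : ℕ) < t then Real.exp (θ * l + l ^ 2 / 2) else 1 := by
    intro i
    split_ifs
    · exact integral_exp_mul_gaussianReal θ l
    · simp
  simp_rw [this]
  rw [← Finset.prod_filter, Finset.prod_const, hcard, ← Real.exp_nat_mul]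

lemma prob_le_partialSum_le {m t : ℕ} (ht : t ≤ m) (θ r : ℝ) {l : ℝ} (hl : 0 ≤ l) :
    (rewardKernel m θ).real {y | r ≤ partialSum t y} ≤
      Real.exp (-l * r + t * (θ * l + l ^ 2 / 2)) := by
  refine (measure_ge_le_exp_mul_mgf r hl (integrable_exp_mul_partialSum m t θ l)).trans_eq ?_
  rw [mgf_partialSum ht, ← Real.exp_add]

lemma prob_partialSum_le_le {m t : ℕ} (ht : t ≤ m) (θ r : ℝ) {l : ℝ} (hl : l ≤ 0) :
    (rewardKernel m θ).real {y | partialSum t y ≤ r} ≤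
      Real.exp (-l * r + t * (θ * l + l ^ 2 / 2)) := by
  refine (measure_le_le_exp_mul_mgf r hl (integrable_exp_mul_partialSum m t θ l)).trans_eq ?_
  rw [mgf_partialSum ht, ← Real.exp_add]

/-- The rewards with `Y₁ + ⋯ + Yₜ < t (γ - a / √t)`, at which an arm is abandoned at time `t`. -/
def failSet (m t : ℕ) (γ a : ℝ) : Set (Fin m → ℝ) :=
  {y | partialSum t y < t * (γ - a / Real.sqrt t)}

lemma measurableSet_failSet (m t : ℕ) (γ a : ℝ) : MeasurableSet (failSet m t γ a) :=
  measurableSet_lt (measurable_partialSum t) measurable_const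

lemma prob_failSet_le {m t : ℕ} (ht : t ≤ m) (ht0 : 1 ≤ t) {γ θ a : ℝ} (ha : 0 ≤ a)
    (hθ : γ ≤ θ) : (rewardKernel m θ).real (failSet m t γ a) ≤ Real.exp (-a ^ 2 / 2) := by
  have ht' : (0 : ℝ) < t := by exact_mod_cast ht0
  have hs : 0 < Real.sqrt t := Real.sqrt_pos.2 ht'
  have hsq : (t : ℝ) = Real.sqrt t ^ 2 := (Real.sq_sqrt ht'.le).symm
  have hsub : failSet m t γ a ⊆ {y | partialSum t y ≤ t * (γ - a / Real.sqrt t)} := by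
    intro y hy
    simp only [failSet, Set.mem_ofPred_eq] at hy ⊢
    exact hy.le
  refine (measureReal_mono hsub).trans
    ((prob_partialSum_le_le ht θ (t * (γ - a / Real.sqrt t)) (l := -(a / Real.sqrt t))
      (by have : 0 ≤ a / Real.sqrt t := by positivity
          linarith)).trans (Real.exp_le_exp.2 ?_))
  have h1 : (t : ℝ) * (a / Real.sqrt t) * (γ - θ) ≤ 0 :=
    mul_nonpos_of_nonneg_of_nonpos (by positivity) (by linarith)
  have h2 : (t : ℝ) * (a / Real.sqrt t) ^ 2 = a ^ 2 := by
    rw [div_pow, ← hsq]; field_simp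
  nlinarith

/-- A Chernoff bound whose tilt is independent of θ. The exponent is then linear in θ, so it
integrates explicitly against the prior, and L remains free to be tuned later. -/
lemma prob_compl_failSet_le {m t : ℕ} (ht : t ≤ m) (ht0 : 1 ≤ t) {γ a σ L : ℝ} (θ : ℝ)
    (ha : 0 ≤ a) (hσ : 0 < σ) (hL : 0 ≤ L) (hLt : L ≤ σ * Real.sqrt t) :
    (rewardKernel m θ).real (failSet m t γ a)ᶜ ≤
      Real.exp (a + 1 / 2) * Real.exp (-(L * ((γ - θ) / σ))) := by
  have ht' : (0 : ℝ) < t := by exact_mod_cast ht0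
  have hs : 0 < Real.sqrt t := Real.sqrt_pos.2 ht'
  have hsq : (t : ℝ) = Real.sqrt t ^ 2 := (Real.sq_sqrt ht'.le).symm
  have hset : (failSet m t γ a)ᶜ = {y | t * (γ - a / Real.sqrt t) ≤ partialSum t y} := by
    ext y; simp [failSet]
  rw [hset, ← Real.exp_add]
  refine (prob_le_partialSum_le ht θ _ (l := L / (σ * t)) (by positivity)).trans
    (Real.exp_le_exp.2 ?_)
  set q := L / (σ * Real.sqrt t) with hq
  have hq0 : 0 ≤ q := by positivity
  have hq1 : q ≤ 1 := (div_le_one (by positivity)).2 hLt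
  have h1 : -(L / (σ * t)) * (t * (γ - a / Real.sqrt t)) +
      t * (θ * (L / (σ * t)) + (L / (σ * t)) ^ 2 / 2) =
      q * a + q ^ 2 / 2 + -(L * ((γ - θ) / σ)) := by
    rw [hq]
    generalize Real.sqrt t = s at *
    rw [hsq]
    field_simp
    ring
  rw [h1]
  nlinarith [mul_le_mul_of_nonneg_right hq1 ha]

/-! ### The stopping value, existence of the maximum, and the upper bound -/

section StoppingValue

variable {ν : ℝ} {v : ℝ≥0} {m : ℕ} {τ : ℝ × (Fin m → ℝ) → ℕ}

lemma measurable_of_mem_stoppingTimes (hτ : τ ∈ stoppingTimes m) : Measurable τ := by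
  refine measurable_to_countable' fun n => ?_
  have h := (rewardFiltration m).le n _ (hτ.1.measurableSet_eq n)
  convert h using 1
  ext ω
  simp

lemma measurable_cast_of_mem_stoppingTimes (hτ : τ ∈ stoppingTimes m) :
    Measurable fun ω => (τ ω : ℝ) :=
  measurable_from_top.comp (measurable_of_mem_stoppingTimes hτ)

lemma integrable_cast_of_mem_stoppingTimes (hτ : τ ∈ stoppingTimes m) :
    Integrable (fun ω => (τ ω : ℝ)) (jointLaw ν v m) := by
  refine Integrable.of_bound (measurable_cast_of_mem_stoppingTimes hτ).aestronglyMeasurable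
    (m : ℝ) (ae_of_all _ fun ω => ?_)
  simpa using (hτ.2 ω).2

lemma integrable_reward (hτ : τ ∈ stoppingTimes m) (γ : ℝ) :
    Integrable (fun ω => (ω.1 - γ) * (τ ω : ℝ)) (jointLaw ν v m) := by
  have h := integrable_comp_fst_jointLaw (m := m)
    ((integrable_id_gaussianReal ν v).sub (integrable_const γ))
  refine h.mul_bdd (c := m) (measurable_cast_of_mem_stoppingTimes hτ).aestronglyMeasurable
    (ae_of_all _ fun ω => ?_)
  simpa using (hτ.2 ω).2

/-- A player who learns the mean after the first round does at least as well. -/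
lemma integral_reward_le (hτ : τ ∈ stoppingTimes m) (γ : ℝ) :
    ∫ ω, (ω.1 - γ) * (τ ω : ℝ) ∂(jointLaw ν v m) ≤
      (ν - γ) + (m - 1) * ∫ θ, max (θ - γ) 0 ∂(gaussianReal ν v) := by
  have h1 : Integrable (fun θ => θ - γ) (gaussianReal ν v) :=
    (integrable_id_gaussianReal ν v).sub (integrable_const γ)
  have h2 : Integrable (fun θ => ((m : ℝ) - 1) * max (θ - γ) 0) (gaussianReal ν v) :=
    (integrable_max_sub_gaussianReal ν v γ).const_mul _
  calc _ ≤ ∫ ω, ((ω.1 - γ) + (m - 1) * max (ω.1 - γ) 0) ∂(jointLaw ν v m) := by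
        refine integral_mono (integrable_reward hτ γ)
          (integrable_comp_fst_jointLaw (h1.add h2)) fun ω => ?_
        have ha : (1 : ℝ) ≤ τ ω := by exact_mod_cast (hτ.2 ω).1
        have hb : (τ ω : ℝ) ≤ m := by exact_mod_cast (hτ.2 ω).2
        have hc := le_max_left (ω.1 - γ) 0
        have hd := le_max_right (ω.1 - γ) 0
        simp only
        nlinarith [mul_le_mul_of_nonneg_right hc (sub_nonneg.2 ha),
          mul_le_mul_of_nonneg_right hb hd]
    _ = ∫ θ, ((θ - γ) + (m - 1) * max (θ - γ) 0) ∂(gaussianReal ν v) :=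
        integral_comp_fst_jointLaw (h := fun θ => (θ - γ) + (m - 1) * max (θ - γ) 0)
          (by fun_prop)
    _ = _ := by
        rw [integral_add h1 h2, integral_sub (integrable_id_gaussianReal ν v) (integrable_const γ),
          integral_const_mul, integral_id_gaussianReal]
        simp

lemma one_mem_stoppingTimes (hm : 1 ≤ m) : (fun _ => 1) ∈ stoppingTimes m :=
  ⟨isStoppingTime_const _ 1, fun _ => ⟨le_rfl, hm⟩⟩

lemma bddAbove_rewards (ν : ℝ) (v : ℝ≥0) (m : ℕ) (γ : ℝ) :
    BddAbove ((fun τ : ℝ × (Fin m → ℝ) → ℕ =>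
      ∫ ω, (ω.1 - γ) * (τ ω : ℝ) ∂(jointLaw ν v m)) '' stoppingTimes m) := by
  refine ⟨(ν - γ) + (m - 1) * ∫ θ, max (θ - γ) 0 ∂(gaussianReal ν v), ?_⟩
  rintro _ ⟨τ, hτ, rfl⟩
  exact integral_reward_le hτ γ

lemma integral_reward_le_stoppingValue (hτ : τ ∈ stoppingTimes m) (γ : ℝ) :
    ∫ ω, (ω.1 - γ) * (τ ω : ℝ) ∂(jointLaw ν v m) ≤ stoppingValue ν v m γ :=
  le_csSup (bddAbove_rewards ν v m γ) ⟨τ, hτ, rfl⟩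

lemma stoppingValue_le (hm : 1 ≤ m) {γ r : ℝ}
    (h : ∀ τ ∈ stoppingTimes m, ∫ ω, (ω.1 - γ) * (τ ω : ℝ) ∂(jointLaw ν v m) ≤ r) :
    stoppingValue ν v m γ ≤ r := by
  refine csSup_le ⟨_, _, one_mem_stoppingTimes hm, rfl⟩ ?_
  rintro _ ⟨τ, hτ, rfl⟩
  exact h τ hτ

/-- For each fixed τ the reward is affine in γ with slope -E τ, and τ ≤ m. -/
lemma lipschitzWith_stoppingValue (hm : 1 ≤ m) :
    LipschitzWith m (stoppingValue ν v m) := by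
  refine LipschitzWith.of_le_add_mul _ fun γ γ' => stoppingValue_le hm fun τ hτ => ?_
  have h1 := integral_reward_le_stoppingValue (ν := ν) (v := v) hτ γ'
  have h2 : ∫ ω, (ω.1 - γ) * (τ ω : ℝ) ∂(jointLaw ν v m) ≤
      ∫ ω, ((ω.1 - γ') * (τ ω : ℝ) + m * dist γ γ') ∂(jointLaw ν v m) := by
    refine integral_mono (integrable_reward hτ γ)
      ((integrable_reward hτ γ').add (integrable_const _)) fun ω => ?_
    have hb : (τ ω : ℝ) ≤ m := by exact_mod_cast (hτ.2 ω).2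
    have hc : γ' - γ ≤ dist γ γ' := by
      rw [dist_comm, Real.dist_eq]; exact le_abs_self _
    have := mul_le_mul hc hb (Nat.cast_nonneg _) dist_nonneg
    simp only
    nlinarith
  rw [integral_add (integrable_reward hτ γ') (integrable_const _)] at h2
  simp only [integral_const, probReal_univ, one_smul] at h2
  simpa using h2.trans (add_le_add_left h1 _)

lemma isClosed_indexSet (hm : 1 ≤ m) : IsClosed (indexSet ν v m) :=
  isClosed_le continuous_const (lipschitzWith_stoppingValue hm).continuous

lemma mem_indexSet_self (hm : 1 ≤ m) : ν ∈ indexSet ν v m := by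
  refine le_trans ?_ (integral_reward_le_stoppingValue (one_mem_stoppingTimes hm) ν)
  have := integral_comp_fst_jointLaw (ν := ν) (v := v) (m := m) (h := fun θ => θ - ν)
    (by fun_prop)
  simp only [Nat.cast_one, mul_one]
  rw [this, integral_sub (integrable_id_gaussianReal ν v) (integrable_const ν),
    integral_id_gaussianReal]
  simp

lemma integral_max_sub_gaussianReal (x : ℝ) :
    ∫ θ, max (θ - (ν + Real.sqrt v * x)) 0 ∂(gaussianReal ν v) =
      Real.sqrt v * expectedExcess x := by
  rw [integral_gaussianReal_eq ν v (by fun_prop), expectedExcess, ← integral_const_mul]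
  congr 1
  ext z
  rw [mul_max_of_nonneg _ _ (Real.sqrt_nonneg _)]
  ring_nf

/-- A point of the index set is at most `ν` in the degenerate case. -/
lemma le_of_mem_indexSet_zero (hm : 1 ≤ m) {γ : ℝ} (h : γ ∈ indexSet ν 0 m) : γ ≤ ν := by
  by_contra! hγ
  have h1 : stoppingValue ν 0 m γ ≤ ν - γ :=
    stoppingValue_le hm fun τ hτ => (integral_reward_le hτ γ).trans_eq (by
      simp [gaussianReal_zero_var, max_eq_right (sub_nonpos.2 hγ.le)])
  have h2 : 0 ≤ stoppingValue ν 0 m γ := h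
  linarith

lemma le_mul_expectedExcess_of_mem_indexSet (hm : 1 ≤ m) (hv : 0 < v) {x : ℝ}
    (h : ν + Real.sqrt v * x ∈ indexSet ν v m) : x ≤ (m - 1) * expectedExcess x := by
  have hs : 0 < Real.sqrt v := Real.sqrt_pos.2 hv
  have h1 : stoppingValue ν v m (ν + Real.sqrt v * x) ≤
      Real.sqrt v * ((m - 1) * expectedExcess x - x) :=
    stoppingValue_le hm fun τ hτ => (integral_reward_le hτ _).trans_eq (by
      rw [integral_max_sub_gaussianReal]; ring)
  have h2 : 0 ≤ stoppingValue ν v m (ν + Real.sqrt v * x) := h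
  have h3 := nonneg_of_mul_nonneg_right (h2.trans h1) hs
  linarith

lemma cube_mul_exp_le_of_mem_indexSet (hm : 1 ≤ m) (hv : 0 < v) {x : ℝ} (hx : 0 < x)
    (h : ν + Real.sqrt v * x ∈ indexSet ν v m) :
    x ^ 3 * Real.exp (x ^ 2 / 2) * Real.sqrt (2 * Real.pi) ≤ m := by
  have hm' : (1 : ℝ) ≤ m := by exact_mod_cast hm
  have h1 := (le_mul_expectedExcess_of_mem_indexSet hm hv h).trans
    (mul_le_mul_of_nonneg_left (expectedExcess_le hx) (by linarith))
  have hp : 0 < Real.sqrt (2 * Real.pi) := by positivity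
  have he := Real.exp_pos (x ^ 2 / 2)
  rw [neg_div, Real.exp_neg] at h1
  generalize Real.exp (x ^ 2 / 2) = e at *
  generalize Real.sqrt (2 * Real.pi) = p at *
  have h2 : ((m : ℝ) - 1) * (p⁻¹ * e⁻¹ / x ^ 2) = (m - 1) / (p * e * x ^ 2) := by
    field_simp
  rw [h2, le_div_iff₀ (by positivity)] at h1
  nlinarith

lemma bddAbove_indexSet (hm : 1 ≤ m) : BddAbove (indexSet ν v m) := by
  rcases eq_or_lt_of_le (zero_le : 0 ≤ v) with rfl | hv
  · exact ⟨ν, fun γ h => le_of_mem_indexSet_zero hm h⟩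
  have hs : 0 < Real.sqrt v := Real.sqrt_pos.2 hv
  have hm' : (1 : ℝ) ≤ m := by exact_mod_cast hm
  refine ⟨ν + Real.sqrt v * m, fun γ h => ?_⟩
  by_contra! hγ
  obtain ⟨x, rfl⟩ : ∃ x, γ = ν + Real.sqrt v * x :=
    ⟨(γ - ν) / Real.sqrt v, by field_simp; ring⟩
  have hx : (m : ℝ) < x := lt_of_mul_lt_mul_left (by linarith) hs.le
  have h1 := cube_mul_exp_le_of_mem_indexSet hm hv (by linarith) h
  have h2 : 1 ≤ Real.exp (x ^ 2 / 2) := Real.one_le_exp (by positivity)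
  have h3 : 1 ≤ Real.sqrt (2 * Real.pi) :=
    Real.one_le_sqrt.2 (by linarith [Real.pi_gt_three])
  have h4 : x ≤ x ^ 3 := le_self_pow₀ (by linarith) (by norm_num)
  have h5 : x * 1 * 1 ≤ x ^ 3 * Real.exp (x ^ 2 / 2) * Real.sqrt (2 * Real.pi) := by
    have : 0 < x := by linarith
    gcongr
  linarith

lemma isGreatest_gittinsIndex (hm : 1 ≤ m) :
    IsGreatest (indexSet ν v m) (gittinsIndex ν v m) :=
  ⟨(isClosed_indexSet hm).csSup_mem ⟨ν, mem_indexSet_self hm⟩ (bddAbove_indexSet hm),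
    fun _ h => le_csSup (bddAbove_indexSet hm) h⟩

lemma le_gittinsIndex (hm : 1 ≤ m) : ν ≤ gittinsIndex ν v m :=
  (isGreatest_gittinsIndex hm).2 (mem_indexSet_self hm)

end StoppingValue

/-! ### Solving x³ exp(x²/2) √(2π) ≤ m for exp(x²/2) -/

lemma three_mul_log_le {l : ℝ} (hl : 0 < l) : 3 * Real.log l ≤ 6 / 5 * l := by
  have h1 := Real.log_le_sub_one_of_pos (div_pos hl (Real.exp_pos 1))
  rw [Real.log_div hl.ne' (Real.exp_pos 1).ne', Real.log_exp] at h1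
  have h2 : l / Real.exp 1 ≤ 2 / 5 * l := by
    rw [div_le_iff₀ (Real.exp_pos 1)]
    nlinarith [Real.exp_one_gt_d9]
  linarith

lemma log_div_log_rpow {m : ℕ} (hm : 2 ≤ m) :
    Real.log ((m : ℝ) / Real.log m ^ (3 / 2 : ℝ)) =
      Real.log m - 3 / 2 * Real.log (Real.log m) := by
  have hm' : (2 : ℝ) ≤ m := by exact_mod_cast hm
  have hl : 0 < Real.log m := Real.log_pos (by linarith)
  rw [Real.log_div (by positivity) (by positivity), Real.log_rpow hl]

lemma one_le_div_log_rpow {m : ℕ} (hm : 2 ≤ m) : 1 ≤ (m : ℝ) / Real.log m ^ (3 / 2 : ℝ) := by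
  have hm' : (2 : ℝ) ≤ m := by exact_mod_cast hm
  have hl : 0 < Real.log m := Real.log_pos (by linarith)
  have h := log_div_log_rpow hm
  have h2 := three_mul_log_le hl
  by_contra! hlt
  have := Real.log_neg (by positivity) hlt
  linarith

/-- If the bound failed, then x² > 2 log m - 3 log log m ≥ (4/5) log m, and x³ would be too large
for the hypothesis. -/
lemma exp_le_div_log_rpow {m : ℕ} (hm : 2 ≤ m) {x : ℝ} (hx : 0 < x)
    (h : x ^ 3 * Real.exp (x ^ 2 / 2) * Real.sqrt (2 * Real.pi) ≤ m) :
    Real.exp (x ^ 2 / 2) ≤ (m : ℝ) / Real.log m ^ (3 / 2 : ℝ) := by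
  have hm' : (2 : ℝ) ≤ m := by exact_mod_cast hm
  have hl : 0 < Real.log m := Real.log_pos (by linarith)
  have h3l := three_mul_log_le hl
  by_contra! hlt
  have h1 := (Real.log_lt_log (by positivity) hlt)
  rw [log_div_log_rpow hm, Real.log_exp] at h1
  set l := Real.log m with hldef
  have hx2 : 4 / 5 * l < x ^ 2 := by linarith
  have hs : 2 ≤ Real.sqrt (2 * Real.pi) := by
    refine Real.le_sqrt_of_sq_le ?_
    nlinarith [Real.pi_gt_three]
  have h4 : (m : ℝ) < l ^ (3 / 2 : ℝ) * Real.exp (x ^ 2 / 2) := by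
    rwa [div_lt_iff₀' (by positivity)] at hlt
  have h5 : x ^ 3 * 2 * Real.exp (x ^ 2 / 2) < l ^ (3 / 2 : ℝ) * Real.exp (x ^ 2 / 2) := by
    refine lt_of_le_of_lt (le_trans ?_ h) h4
    have : 0 < x ^ 3 * Real.exp (x ^ 2 / 2) := by positivity
    nlinarith
  have h6 : x ^ 3 * 2 < l ^ (3 / 2 : ℝ) := lt_of_mul_lt_mul_right h5 (Real.exp_pos _).le
  have h7 : (x ^ 3 * 2) ^ 2 < l ^ 3 := by
    have : (l ^ (3 / 2 : ℝ)) ^ 2 = l ^ 3 := by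
      rw [← Real.rpow_natCast, ← Real.rpow_mul hl.le, ← Real.rpow_natCast]
      norm_num
    rw [← this]
    gcongr
  have h8 : (4 / 5 * l) ^ 3 < (x ^ 2) ^ 3 := by gcongr
  nlinarith [pow_pos hl 3]

/-! ### Stopping rules built from tests -/

open Classical in
/-- Stop at the first of the times `t 0, …, t J` whose test fails, that is, for which the rewards
lie in `E j`, and at time `m` if no test fails. -/
noncomputable def testRule {m : ℕ} (J : ℕ) (t : ℕ → ℕ) (E : ℕ → Set (Fin m → ℝ))
    (ω : ℝ × (Fin m → ℝ)) : ℕ :=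
  (Finset.range (J + 1)).inf' Finset.nonempty_range_add_one fun j => if ω.2 ∈ E j then t j else m

lemma measurableSet_failSet_rewardFiltration (m t : ℕ) (γ a : ℝ) :
    MeasurableSet[rewardFiltration m t]
      {ω : ℝ × (Fin m → ℝ) | ω.2 ∈ failSet m t γ a} := by
  have h : Measurable[rewardFiltration m t]
      fun ω : ℝ × (Fin m → ℝ) => partialSum t ω.2 := by
    unfold partialSum
    refine Finset.measurable_sum _ fun i hi => ?_
    have hi' : (i : ℕ) < t := (Finset.mem_filter.1 hi).2
    have h1 : MeasurableSpace.comap (fun ω : ℝ × (Fin m → ℝ) => ω.2 i) inferInstance ≤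
        rewardFiltration m t :=
      le_iSup₂_of_le (f := fun (s : Fin m) (_ : (s : ℕ) < t) =>
        MeasurableSpace.comap (fun ω : ℝ × (Fin m → ℝ) => ω.2 s) inferInstance) i hi' le_rfl
    exact (comap_measurable _).mono h1 le_rfl
  convert h (measurableSet_Iio (a := t * (γ - a / Real.sqrt t))) using 1
  ext ω
  simp [failSet]

section TestRule

variable {m J : ℕ} {t : ℕ → ℕ} {E : ℕ → Set (Fin m → ℝ)}

lemma testRule_mem_stoppingTimes (ht : ∀ j ≤ J, 1 ≤ t j ∧ t j ≤ m)
    (hE : ∀ j, MeasurableSet[rewardFiltration m (t j)] {ω : ℝ × (Fin m → ℝ) | ω.2 ∈ E j}) :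
    testRule J t E ∈ stoppingTimes m := by
  have hm : 1 ≤ m := (ht 0 (Nat.zero_le _)).1.trans (ht 0 (Nat.zero_le _)).2
  have hle : ∀ ω, testRule J t E ω ≤ m := fun ω => by
    refine (Finset.inf'_le _ (Finset.mem_range.2 (Nat.succ_pos J))).trans ?_
    split_ifs
    exacts [(ht 0 (Nat.zero_le _)).2, le_rfl]
  refine ⟨fun n => ?_, fun ω => ⟨?_, hle ω⟩⟩
  · by_cases hn : m ≤ n
    · convert MeasurableSet.univ using 1
      exact Set.eq_univ_of_forall fun ω => by simpa using (hle ω).trans hn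
    -- Before the horizon, only a failed test can have stopped the rule.
    · have hset : {ω | ((testRule J t E ω : ℕ) : WithTop ℕ) ≤ n} =
          ⋃ j ∈ Finset.range (J + 1), {ω | t j ≤ n ∧ ω.2 ∈ E j} := by
        ext ω
        simp only [Set.mem_ofPred_eq, Nat.cast_withTop, WithTop.coe_le_coe, testRule,
          Set.mem_iUnion, exists_prop]
        rw [Finset.inf'_le_iff]
        refine exists_congr fun j => and_congr_right fun _ => ?_
        by_cases hj : ω.2 ∈ E j <;> simp [hj, hn]
      change MeasurableSet[rewardFiltration m n] {ω | ((testRule J t E ω : ℕ) : WithTop ℕ) ≤ n}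
      rw [hset]
      refine Finset.measurableSet_biUnion _ fun j _ => ?_
      by_cases hj : t j ≤ n
      · simpa [hj] using (rewardFiltration m).mono hj _ (hE j)
      · simp [hj]
  · refine (Finset.le_inf'_iff _ _).2 fun j hj => ?_
    split_ifs
    exacts [(ht j (Nat.lt_succ_iff.1 (Finset.mem_range.1 hj))).1, hm]

lemma le_testRule (ω : ℝ × (Fin m → ℝ)) :
    (m : ℝ) * (1 - ∑ j ∈ Finset.range (J + 1), (E j).indicator 1 ω.2) ≤ testRule J t E ω := by
  have hnn : ∀ j ∈ Finset.range (J + 1), (0 : ℝ) ≤ (E j).indicator 1 ω.2 :=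
    fun j _ => Set.indicator_nonneg (fun _ _ => zero_le_one) _
  by_cases h : ∃ j ∈ Finset.range (J + 1), ω.2 ∈ E j
  · obtain ⟨j, hj, hjE⟩ := h
    have h1 : (1 : ℝ) ≤ ∑ j ∈ Finset.range (J + 1), (E j).indicator 1 ω.2 := by
      refine le_trans ?_ (Finset.single_le_sum hnn hj)
      simp [hjE]
    exact (mul_nonpos_of_nonneg_of_nonpos (Nat.cast_nonneg _) (by linarith)).trans
      (Nat.cast_nonneg _)
  · push Not at h
    have h1 : m ≤ testRule J t E ω :=
      (Finset.le_inf'_iff _ _).2 fun j hj => by simp [h j hj]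
    have h2 : (m : ℝ) ≤ testRule J t E ω := by exact_mod_cast h1
    refine le_trans ?_ h2
    have := Finset.sum_nonneg hnn
    nlinarith [(Nat.cast_nonneg m : (0 : ℝ) ≤ m)]

/-- If the first failure is at test j + 1, then test j was passed and its term pays for `t (j + 1)`;
if no test up to J fails, the last term pays for m. -/
lemma testRule_le (ω : ℝ × (Fin m → ℝ)) :
    (testRule J t E ω : ℝ) ≤ t 0 + ∑ j ∈ Finset.range J, (t (j + 1) : ℝ) * (E j)ᶜ.indicator 1 ω.2 +
      m * (E J)ᶜ.indicator 1 ω.2 := by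
  have hI : ∀ j, (0 : ℝ) ≤ (E j)ᶜ.indicator 1 ω.2 :=
    fun j => Set.indicator_nonneg (fun _ _ => zero_le_one) _
  have hnn : ∀ j ∈ Finset.range J, (0 : ℝ) ≤ (t (j + 1) : ℝ) * (E j)ᶜ.indicator 1 ω.2 :=
    fun j _ => mul_nonneg (Nat.cast_nonneg _) (hI j)
  have hs := Finset.sum_nonneg hnn
  have hJ : (0 : ℝ) ≤ m * (E J)ᶜ.indicator 1 ω.2 := mul_nonneg (Nat.cast_nonneg _) (hI J)
  have hle : ∀ j ≤ J, ω.2 ∈ E j → (testRule J t E ω : ℝ) ≤ t j := fun j hj hjE => by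
    have : testRule J t E ω ≤ t j :=
      (Finset.inf'_le _ (Finset.mem_range.2 (Nat.lt_succ_of_le hj))).trans (by simp [hjE])
    exact_mod_cast this
  have ht0 : (0 : ℝ) ≤ t 0 := Nat.cast_nonneg _
  classical
  by_cases h : ∃ j, ω.2 ∈ E j
  · obtain ⟨k, hk⟩ : ∃ k, k = Nat.find h := ⟨_, rfl⟩
    have hkE : ω.2 ∈ E k := hk ▸ Nat.find_spec h
    have hlt : ∀ j < k, ω.2 ∉ E j := fun j hj => Nat.find_min h (hk ▸ hj)
    rcases lt_or_ge J k with hJk | hkJ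
    · have h1 : testRule J t E ω ≤ m :=
        (Finset.inf'_le _ (Finset.mem_range.2 (Nat.lt_succ_self J))).trans (by simp [hlt J hJk])
      have h2 : (testRule J t E ω : ℝ) ≤ m := by exact_mod_cast h1
      simp only [Set.indicator_of_mem (Set.mem_compl (hlt J hJk)), Pi.one_apply, mul_one]
      linarith
    · have h1 := hle k hkJ hkE
      rcases k with _ | j
      · linarith
      · have h2 := Finset.single_le_sum hnn (Finset.mem_range.2 (Nat.lt_of_succ_le hkJ))
        simp only [Set.indicator_of_mem (Set.mem_compl (hlt j (Nat.lt_succ_self j))),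
          Pi.one_apply, mul_one] at h2
        linarith
  · push Not at h
    have h1 : testRule J t E ω ≤ m :=
      (Finset.inf'_le _ (Finset.mem_range.2 (Nat.lt_succ_self J))).trans (by simp [h J])
    have h2 : (testRule J t E ω : ℝ) ≤ m := by exact_mod_cast h1
    simp only [Set.indicator_of_mem (Set.mem_compl (h J)), Pi.one_apply, mul_one]
    linarith

/-- The reward of a test rule in terms of the error probabilities of its tests. -/
lemma le_integral_reward_testRule (ν : ℝ) (v : ℝ≥0) (γ : ℝ)
    (ht : ∀ j ≤ J, 1 ≤ t j ∧ t j ≤ m)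
    (hE : ∀ j, MeasurableSet[rewardFiltration m (t j)] {ω : ℝ × (Fin m → ℝ) | ω.2 ∈ E j})
    (hE' : ∀ j, MeasurableSet (E j)) :
    m * (∫ θ, max (θ - γ) 0 ∂(gaussianReal ν v) - ∑ j ∈ Finset.range (J + 1),
        ∫ θ, max (θ - γ) 0 * (rewardKernel m θ).real (E j) ∂(gaussianReal ν v)) -
      (t 0 * ∫ θ, max (γ - θ) 0 ∂(gaussianReal ν v) +
        ∑ j ∈ Finset.range J, t (j + 1) *
          ∫ θ, max (γ - θ) 0 * (rewardKernel m θ).real (E j)ᶜ ∂(gaussianReal ν v) +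
        m * ∫ θ, max (γ - θ) 0 * (rewardKernel m θ).real (E J)ᶜ ∂(gaussianReal ν v)) ≤
      ∫ ω, (ω.1 - γ) * (testRule J t E ω : ℝ) ∂(jointLaw ν v m) := by
  have hP := integrable_max_sub_gaussianReal ν v γ
  have hN := integrable_max_const_sub_gaussianReal ν v γ
  have iP := integrable_comp_fst_jointLaw (m := m) hP
  have iN := integrable_comp_fst_jointLaw (m := m) hN
  have iPE := fun j => integrable_mul_indicator_jointLaw hP (hE' j)
  have iNE := fun j => integrable_mul_indicator_jointLaw hN (hE' j).compl
  have iS := integrable_finsetSum (Finset.range (J + 1)) fun j _ => iPE j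
  have iT := integrable_finsetSum (Finset.range J) fun j _ => (iNE j).const_mul (t (j + 1) : ℝ)
  have iA := (iP.sub iS).const_mul (m : ℝ)
  have iB := ((iN.const_mul (t 0 : ℝ)).add iT).add ((iNE J).const_mul (m : ℝ))
  have hτ := testRule_mem_stoppingTimes ht hE
  have key := integral_mono (iA.sub iB) (integrable_reward (ν := ν) (v := v) hτ γ) fun ω => by
    have h1 := le_testRule (J := J) (t := t) (E := E) ω
    have h2 := testRule_le (J := J) (t := t) (E := E) ω
    have h3 := mul_le_mul_of_nonneg_left h1 (le_max_right (ω.1 - γ) 0)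
    have h4 := mul_le_mul_of_nonneg_left h2 (le_max_right (γ - ω.1) 0)
    -- The lower bound on τ is used on the positive part and the upper bound on the negative part.
    have h5 : ω.1 - γ = max (ω.1 - γ) 0 - max (γ - ω.1) 0 := by
      rcases le_total ω.1 γ with h | h
      · rw [max_eq_right (by linarith), max_eq_left (by linarith)]; ring
      · rw [max_eq_left (by linarith), max_eq_right (by linarith)]; ring
    simp only [Pi.sub_apply, Pi.add_apply]
    rw [congrArg (· * (testRule J t E ω : ℝ)) h5, sub_mul]
    refine le_trans (le_of_eq ?_) (sub_le_sub h3 h4)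
    simp only [mul_add, mul_sub, Finset.mul_sum, ← mul_assoc, mul_one]
    simp only [mul_comm]
  rw [integral_sub' iA iB, integral_add' ((iN.const_mul (t 0 : ℝ)).add iT) ((iNE J).const_mul _),
    integral_add' (iN.const_mul (t 0 : ℝ)) iT, integral_finsetSum _ fun j _ =>
      (iNE j).const_mul (t (j + 1) : ℝ)] at key
  simp only [integral_const_mul, Pi.sub_apply] at key
  rw [integral_sub iP iS, integral_finsetSum _ fun j _ => iPE j] at key
  simp only [integral_mul_indicator_jointLaw hP (hE' _),
    integral_mul_indicator_jointLaw hN (hE' _).compl] at key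
  rw [integral_comp_fst_jointLaw (h := fun θ => max (θ - γ) 0) (by fun_prop),
    integral_comp_fst_jointLaw (h := fun θ => max (γ - θ) 0) (by fun_prop)] at key
  exact key

end TestRule

/-! ### Numerical estimates for the test schedule -/

lemma exp_five_halves_le : Real.exp (5 / 2) ≤ 13 := by
  have h : Real.exp (5 / 2) ^ 2 = Real.exp 1 ^ 5 := by
    rw [← Real.exp_nat_mul, ← Real.exp_nat_mul]; norm_num
  have h1 : Real.exp 1 ^ 5 ≤ 2.72 ^ 5 := by
    have := Real.exp_one_lt_d9
    gcongr
    linarith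
  nlinarith [Real.exp_pos (5 / 2)]

lemma exp_neg_three_halves_ge : 1 / 5 ≤ Real.exp (-3 / 2) := by
  have h : Real.exp (3 / 2) ^ 2 = Real.exp 1 ^ 3 := by
    rw [← Real.exp_nat_mul, ← Real.exp_nat_mul]; norm_num
  have h1 : Real.exp 1 ^ 3 ≤ 2.72 ^ 3 := by
    have := Real.exp_one_lt_d9
    gcongr
    linarith
  have h2 : Real.exp (3 / 2) ≤ 5 := by nlinarith [Real.exp_pos (3 / 2)]
  rw [neg_div, Real.exp_neg, one_div]
  gcongr

lemma sixteen_pow_le (j : ℕ) : (16 : ℝ) ^ j ≤ Real.exp (3 * j) := by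
  have h1 : (2.7 : ℝ) ^ 3 ≤ Real.exp 1 ^ 3 := by
    have := Real.exp_one_gt_d9
    gcongr
    linarith
  have h2 : Real.exp (3 * (j : ℝ)) = (Real.exp 1 ^ 3) ^ j := by
    rw [← pow_mul, ← Real.exp_nat_mul]; push_cast; ring_nf
  rw [h2]
  gcongr
  linarith

lemma exp_mul_le_four_pow (j : ℕ) : Real.exp (5 / 4 * j) ≤ 4 ^ j := by
  have h1 : Real.exp 1 ^ 5 ≤ 2.72 ^ 5 := by
    have := Real.exp_one_lt_d9
    gcongr
    linarith
  have h : Real.exp (5 / 4) ^ 4 = Real.exp 1 ^ 5 := by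
    rw [← Real.exp_nat_mul, ← Real.exp_nat_mul]; norm_num
  have h2 : Real.exp (5 / 4) ≤ 4 := by
    refine le_of_pow_le_pow_left₀ (n := 4) (by norm_num) (by norm_num) ?_
    rw [h]
    linarith
  have h3 : Real.exp (5 / 4 * (j : ℝ)) = Real.exp (5 / 4) ^ j := by
    rw [← Real.exp_nat_mul]; ring_nf
  rw [h3]
  gcongr

/-- The fourth-order term of the exponential series supplies 256^j, against 16^j e^j ≤ 128^j. -/
lemma sixteen_pow_mul_exp_le (j : ℕ) :
    (16 : ℝ) ^ j * Real.exp j * Real.exp (-(3 / 8 * 4 ^ j)) ≤ 1214 * (1 / 2) ^ j := by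
  have h1 := Real.pow_div_factorial_le_exp (3 / 8 * 4 ^ j : ℝ) (by positivity) 4
  have h2 : Real.exp j ≤ 8 ^ j := by
    have : Real.exp (j : ℝ) = Real.exp 1 ^ j := by rw [← Real.exp_nat_mul]; ring_nf
    rw [this]
    have := Real.exp_one_lt_d9
    gcongr
    linarith
  rw [Real.exp_neg, ← div_eq_mul_inv, div_le_iff₀ (Real.exp_pos _)]
  have h3 : (16 : ℝ) ^ j * 8 ^ j = (1 / 2) ^ j * (4 ^ j) ^ 4 := by
    rw [← pow_mul, mul_comm j 4, pow_mul, ← mul_pow, ← mul_pow]; norm_num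
  have h4 : (3 / 8 * 4 ^ j : ℝ) ^ 4 / (Nat.factorial 4 : ℕ) = 27 / 32768 * (4 ^ j) ^ 4 := by
    rw [mul_pow]; norm_num [Nat.factorial]; ring
  rw [h4] at h1
  calc (16 : ℝ) ^ j * Real.exp j ≤ 16 ^ j * 8 ^ j := by gcongr
    _ = (1 / 2) ^ j * (4 ^ j) ^ 4 := h3
    _ ≤ (1 / 2) ^ j * (1214 * (27 / 32768 * (4 ^ j) ^ 4)) := by
        have : (0 : ℝ) < (4 ^ j) ^ 4 := by positivity
        gcongr
        linarith
    _ ≤ (1 / 2) ^ j * (1214 * Real.exp (3 / 8 * 4 ^ j)) := by gcongr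
    _ = _ := by ring

lemma sum_half_pow_le (n : ℕ) : ∑ j ∈ Finset.range n, (1 / 2 : ℝ) ^ j ≤ 2 := by
  rw [geom_sum_eq (by norm_num)]
  have h : (0 : ℝ) < (1 / 2) ^ n := by positivity
  have h2 : ((1 / 2 : ℝ) ^ n - 1) / (1 / 2 - 1) = 2 * (1 - (1 / 2) ^ n) := by
    norm_num
    linarith
  linarith

lemma sum_sixteen_pow_mul_exp_le {x : ℝ} (hx : 2500 ≤ x) :
    ∑ j ∈ Finset.range ⌈x⌉₊, (16 : ℝ) ^ (j + 1) * (Real.exp ((j + 2 : ℝ) + 1 / 2) *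
      (2 * (Real.exp (-(3 / 8 * 4 ^ j)) + Real.exp (-(3 / 8 * x ^ 2))))) ≤ 1099997 := by
  have hx0 : 0 ≤ x := by linarith
  have hterm : ∀ j ∈ Finset.range ⌈x⌉₊, (16 : ℝ) ^ (j + 1) * (Real.exp ((j + 2 : ℝ) + 1 / 2) *
      (2 * (Real.exp (-(3 / 8 * 4 ^ j)) + Real.exp (-(3 / 8 * x ^ 2))))) ≤
      416 * (1214 * (1 / 2) ^ j + Real.exp (4 * x - 3 / 8 * x ^ 2)) := by
    intro j hj
    have hjx : (j : ℝ) ≤ x := (Nat.lt_ceil.1 (Finset.mem_range.1 hj)).le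
    have h1 := sixteen_pow_mul_exp_le j
    have h2 : (16 : ℝ) ^ j * Real.exp j * Real.exp (-(3 / 8 * x ^ 2)) ≤
        Real.exp (4 * x - 3 / 8 * x ^ 2) := by
      calc _ ≤ Real.exp (3 * j) * Real.exp j * Real.exp (-(3 / 8 * x ^ 2)) := by
            gcongr; exact sixteen_pow_le j
        _ = Real.exp (4 * j - 3 / 8 * x ^ 2) := by
            rw [← Real.exp_add, ← Real.exp_add]; ring_nf
        _ ≤ _ := by gcongr
    have h3 : Real.exp ((j + 2 : ℝ) + 1 / 2) = Real.exp j * Real.exp (5 / 2) := by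
      rw [← Real.exp_add]; ring_nf
    rw [h3]
    have h4 := exp_five_halves_le
    calc _ = 32 * Real.exp (5 / 2) * ((16 : ℝ) ^ j * Real.exp j * Real.exp (-(3 / 8 * 4 ^ j)) +
          (16 : ℝ) ^ j * Real.exp j * Real.exp (-(3 / 8 * x ^ 2))) := by ring
      _ ≤ 32 * 13 * (1214 * (1 / 2) ^ j + Real.exp (4 * x - 3 / 8 * x ^ 2)) := by gcongr
      _ = _ := by norm_num
  refine (Finset.sum_le_sum hterm).trans ?_
  rw [← Finset.mul_sum, Finset.sum_add_distrib, ← Finset.mul_sum, Finset.sum_const,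
    Finset.card_range, nsmul_eq_mul]
  have h1 : (⌈x⌉₊ : ℝ) * Real.exp (4 * x - 3 / 8 * x ^ 2) ≤ 1 := by
    calc _ ≤ Real.exp x * Real.exp (4 * x - 3 / 8 * x ^ 2) := by
          gcongr
          exact (Nat.ceil_lt_add_one hx0).le.trans (Real.add_one_le_exp x)
      _ = Real.exp (x + (4 * x - 3 / 8 * x ^ 2)) := (Real.exp_add _ _).symm
      _ ≤ 1 := Real.exp_le_one_iff.2 (by nlinarith)
  linarith [sum_half_pow_le ⌈x⌉₊]

/-- The sixth-order term suffices once x³ ≥ 3120 · 2949120, which the threshold 2500 covers. The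
factor 3120 = 26 · 120 is what `exp_ceil_mul_inv_sub_le` consumes. -/
lemma cube_le_exp {x : ℝ} (hx : 2500 ≤ x) : 3120 * x ^ 3 ≤ Real.exp (x / 4) := by
  have h := Real.pow_div_factorial_le_exp (x / 4) (by linarith) 6
  refine le_trans ?_ h
  have h1 : (x / 4) ^ 6 / (Nat.factorial 6 : ℕ) = x ^ 3 * (x ^ 3 / 2949120) := by
    norm_num [Nat.factorial]; ring
  have h2 : (2500 : ℝ) ^ 3 ≤ x ^ 3 := by gcongr
  rw [h1, mul_comm]
  gcongr
  linarith

lemma le_four_pow_ceil {x : ℝ} (hx : 2500 ≤ x) : 2 * x ^ 2 ≤ 4 ^ ⌈x⌉₊ := by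
  refine le_trans ?_ (exp_mul_le_four_pow _)
  have h : Real.exp (x / 4) ≤ Real.exp (5 / 4 * ⌈x⌉₊) := by
    refine Real.exp_le_exp.2 ?_
    linarith [Nat.le_ceil x]
  refine le_trans ?_ ((cube_le_exp hx).trans h)
  nlinarith [sq_nonneg x]

lemma exp_ceil_mul_inv_sub_le {x : ℝ} (hx : 2500 ≤ x) :
    Real.exp ((⌈x⌉₊ + 2 : ℝ) + 1 / 2) * (4 ^ ⌈x⌉₊ / x - x)⁻¹ ≤ 1 / 120 / x ^ 2 := by
  have hx0 : 0 < x := by linarith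
  set J := ⌈x⌉₊
  have h1 : (4 : ℝ) ^ J / (2 * x) ≤ 4 ^ J / x - x := by
    have : (4 : ℝ) ^ J / x - x - 4 ^ J / (2 * x) = (4 ^ J - 2 * x ^ 2) / (2 * x) := by
      field_simp; ring
    have h2 : (0 : ℝ) ≤ (4 ^ J - 2 * x ^ 2) / (2 * x) :=
      div_nonneg (by linarith [le_four_pow_ceil hx]) (by linarith)
    linarith
  have h3 : Real.exp ((J + 2 : ℝ) + 1 / 2) ≤ 13 * Real.exp J := by
    have : Real.exp ((J + 2 : ℝ) + 1 / 2) = Real.exp (5 / 2) * Real.exp J := by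
      rw [← Real.exp_add]; ring_nf
    rw [this]
    gcongr
    exact exp_five_halves_le
  have h4 : Real.exp J * (3120 * x ^ 3) ≤ 4 ^ J := by
    calc Real.exp J * (3120 * x ^ 3) ≤ Real.exp J * Real.exp (J / 4) := by
          gcongr
          refine (cube_le_exp hx).trans (Real.exp_le_exp.2 ?_)
          linarith [Nat.le_ceil x]
      _ = Real.exp (5 / 4 * J) := by rw [← Real.exp_add]; ring_nf
      _ ≤ _ := exp_mul_le_four_pow J
  have hp : (0 : ℝ) < 4 ^ J / (2 * x) := by positivity
  have hp' : (0 : ℝ) ≤ (4 ^ J / x - x)⁻¹ := inv_nonneg.2 (hp.le.trans h1)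
  calc _ ≤ 13 * Real.exp J * (4 ^ J / (2 * x))⁻¹ := by gcongr
    _ ≤ 1 / 120 / x ^ 2 := by
      rw [← div_eq_mul_inv, div_le_div_iff₀ hp (by positivity), mul_div_assoc', le_div_iff₀ (by positivity)]
      nlinarith

lemma sixteen_pow_ceil_le {x : ℝ} (hx : 2500 ≤ x) :
    (16 : ℝ) ^ ⌈x⌉₊ ≤ Real.exp (x ^ 2 / 2) * x ^ 3 := by
  have h1 : Real.exp (3 * ⌈x⌉₊) ≤ Real.exp (x ^ 2 / 2) := by
    refine Real.exp_le_exp.2 ?_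
    nlinarith [Nat.ceil_lt_add_one (show 0 ≤ x by linarith)]
  have h2 : (1 : ℝ) ≤ x ^ 3 := one_le_pow₀ (by linarith)
  calc _ ≤ _ := sixteen_pow_le _
    _ ≤ _ := h1
    _ ≤ _ := le_mul_of_one_le_right (Real.exp_pos _).le h2

/-- The offset 2 in the test levels makes the total failure probability of a good arm at most 1/2.
-/
lemma sum_exp_neg_sq_le (n : ℕ) :
    ∑ j ∈ Finset.range n, Real.exp (-(j + 2 : ℝ) ^ 2 / 2) ≤ 1 / 2 := by
  have h : ∀ j ∈ Finset.range n, Real.exp (-(j + 2 : ℝ) ^ 2 / 2) ≤ 1 / 4 * (1 / 2) ^ j := by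
    intro j _
    have h1 : Real.exp (-1) ≤ 1 / 2 := by
      rw [Real.exp_neg, ← one_div]
      have := Real.exp_one_gt_d9
      gcongr
      linarith
    calc Real.exp (-(j + 2 : ℝ) ^ 2 / 2) ≤ Real.exp (((j + 2 : ℕ) : ℝ) * (-1)) := by
          refine Real.exp_le_exp.2 ?_
          push_cast
          nlinarith [(Nat.cast_nonneg j : (0 : ℝ) ≤ j)]
      _ = Real.exp (-1) ^ (j + 2) := Real.exp_nat_mul _ _
      _ ≤ (1 / 2) ^ (j + 2) := by gcongr
      _ = _ := by rw [pow_add]; ring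
  refine (Finset.sum_le_sum h).trans ?_
  rw [← Finset.mul_sum]
  linarith [sum_half_pow_le n]

/-! ### Test errors averaged over the prior -/

section Tests

variable {ν : ℝ} {v : ℝ≥0} {m t : ℕ}

lemma integral_excess_failSet_le (ht : t ≤ m) (ht0 : 1 ≤ t) {γ a : ℝ} (ha : 0 ≤ a) :
    ∫ θ, max (θ - γ) 0 * (rewardKernel m θ).real (failSet m t γ a) ∂(gaussianReal ν v) ≤
      Real.exp (-a ^ 2 / 2) * ∫ θ, max (θ - γ) 0 ∂(gaussianReal ν v) := by
  rw [← integral_const_mul]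
  refine integral_mono_of_nonneg (ae_of_all _ fun θ => by positivity)
    ((integrable_max_sub_gaussianReal ν v γ).const_mul _) (ae_of_all _ fun θ => ?_)
  rcases le_total γ θ with h | h
  · simp only
    rw [mul_comm]
    gcongr
    exact prob_failSet_le ht ht0 ha h
  · simp [max_eq_right (sub_nonpos.2 h)]

lemma integral_max_const_sub_gaussianReal (x : ℝ) :
    ∫ θ, max (ν + Real.sqrt v * x - θ) 0 ∂(gaussianReal ν v) =
      Real.sqrt v * ∫ z, max (x - z) 0 ∂(gaussianReal 0 1) := by
  rw [integral_gaussianReal_eq ν v (by fun_prop), ← integral_const_mul]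
  congr 1
  ext z
  rw [mul_max_of_nonneg _ _ (Real.sqrt_nonneg _)]
  ring_nf

lemma integral_shortfall_compl_failSet_le (ht : t ≤ m) (ht0 : 1 ≤ t) (hv : 0 < v)
    {x a L k : ℝ} (ha : 0 ≤ a) (hL : 0 ≤ L) (hLt : L ≤ Real.sqrt v * Real.sqrt t) (hk : 0 < k) :
    ∫ θ, max (ν + Real.sqrt v * x - θ) 0 *
        (rewardKernel m θ).real (failSet m t (ν + Real.sqrt v * x) a)ᶜ ∂(gaussianReal ν v) ≤
      Real.sqrt v * (Real.exp (a + 1 / 2) *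
        (k⁻¹ * Real.exp (-((L - k) * x) + (L - k) ^ 2 / 2))) := by
  have hs : 0 < Real.sqrt v := Real.sqrt_pos.2 hv
  set γ := ν + Real.sqrt v * x with hγ
  have hcomp : ∀ z, max (γ - (ν + Real.sqrt v * z)) 0 *
      (Real.exp (a + 1 / 2) * Real.exp (-(L * ((γ - (ν + Real.sqrt v * z)) / Real.sqrt v)))) =
      Real.sqrt v * (Real.exp (a + 1 / 2) * (max (x - z) 0 * Real.exp (-(L * (x - z))))) := by
    intro z
    have h1 : γ - (ν + Real.sqrt v * z) = Real.sqrt v * (x - z) := by rw [hγ]; ring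
    rw [h1, mul_div_cancel_left₀ _ hs.ne', ← mul_zero (Real.sqrt v),
      ← mul_max_of_nonneg _ _ hs.le]
    ring_nf
  have hI : Integrable (fun θ => max (γ - θ) 0 *
      (Real.exp (a + 1 / 2) * Real.exp (-(L * ((γ - θ) / Real.sqrt v))))) (gaussianReal ν v) := by
    rw [gaussianReal_eq_map ν v, integrable_map_measure
      (Measurable.aestronglyMeasurable (by fun_prop)) (by fun_prop)]
    simp only [Function.comp_def, hcomp]
    exact ((integrable_shortfall_mul_exp L x).const_mul _).const_mul _
  refine (integral_mono_of_nonneg (ae_of_all _ fun θ => by positivity) hI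
    (ae_of_all _ fun θ => ?_)).trans ?_
  · exact mul_le_mul_of_nonneg_left (prob_compl_failSet_le ht ht0 θ ha hs hL hLt)
      (le_max_right _ _)
  · rw [integral_gaussianReal_eq ν v (by fun_prop)]
    simp only [hcomp, integral_const_mul]
    gcongr
    exact integral_shortfall_mul_exp_le hk L x

end Tests

/-- With k = L/2 and L ≤ x the exponent is at most -(3/8) L x, and L x = min (4^j) (x²). The sum of
two exponentials covers both cases of the minimum. -/
lemma inv_mul_exp_min_le {x : ℝ} (hx : 1 ≤ x) (j : ℕ) {L : ℝ} (hL : L = min (4 ^ j / x) x) :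
    (L / 2)⁻¹ * Real.exp (-((L - L / 2) * x) + (L - L / 2) ^ 2 / 2) ≤
      x * (2 * (Real.exp (-(3 / 8 * 4 ^ j)) + Real.exp (-(3 / 8 * x ^ 2)))) := by
  have hx0 : 0 < x := by linarith
  have h4 : (1 : ℝ) ≤ 4 ^ j := one_le_pow₀ (by norm_num)
  have hLx : L ≤ x := hL ▸ min_le_right _ _
  have hL1 : x⁻¹ ≤ L := by
    rw [hL, ← one_div]
    refine le_min (by gcongr) ?_
    rw [div_le_iff₀ hx0]
    nlinarith
  have hL0 : 0 < L := lt_of_lt_of_le (by positivity) hL1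
  have h1 : (L / 2)⁻¹ ≤ 2 * x := by
    have : L⁻¹ ≤ x := inv_le_of_inv_le₀ hx0 hL1
    rw [inv_div, div_eq_mul_inv]
    linarith
  have h2 : Real.exp (-((L - L / 2) * x) + (L - L / 2) ^ 2 / 2) ≤ Real.exp (-(3 / 8 * (L * x))) :=
    Real.exp_le_exp.2 (by nlinarith)
  have h3 : Real.exp (-(3 / 8 * (L * x))) ≤
      Real.exp (-(3 / 8 * 4 ^ j)) + Real.exp (-(3 / 8 * x ^ 2)) := by
    rcases min_choice ((4 : ℝ) ^ j / x) x with h | h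
    · rw [hL, h, div_mul_cancel₀ _ hx0.ne']
      linarith [Real.exp_pos (-(3 / 8 * x ^ 2))]
    · rw [hL, h, ← sq]
      linarith [Real.exp_pos (-(3 / 8 * 4 ^ j : ℝ))]
  calc _ ≤ 2 * x * (Real.exp (-(3 / 8 * 4 ^ j)) + Real.exp (-(3 / 8 * x ^ 2))) := by
        gcongr
        exact h2.trans h3
    _ = _ := by ring

lemma four_pow_div_le_sqrt {x v r : ℝ} (hx : 0 < x) (hv : 0 < v) (hr : 1 / (x ^ 2 * v) ≤ r)
    (j : ℕ) : 4 ^ j / x ≤ Real.sqrt v * Real.sqrt (r * 16 ^ j) := by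
  rw [← Real.sqrt_mul hv.le]
  refine Real.le_sqrt_of_sq_le ?_
  have h1 : 1 ≤ r * (x ^ 2 * v) := (div_le_iff₀ (by positivity)).1 hr
  rw [div_pow, div_le_iff₀ (by positivity), ← pow_mul, mul_comm j 2, pow_mul]
  have h2 : (0 : ℝ) < 16 ^ j := by positivity
  norm_num
  nlinarith

/-! ### The lower bound on the index -/

/-- If the horizon is long enough, then geometrically spaced tests keep the reward nonnegative. -/
theorem mem_indexSet_of_horizon_ge (ν : ℝ) {v : ℝ≥0} (hv : 0 < v) {m : ℕ} {x : ℝ} (hx : 2500 ≤ x)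
    (h : 2 * 10 ^ 8 * (Real.exp (x ^ 2 / 2) * x ^ 3 * (1 + 1 / (x ^ 2 * v))) ≤ m) :
    ν + Real.sqrt v * x ∈ indexSet ν v m := by
  have hv' : (0 : ℝ) < v := hv
  have hx0 : 0 < x := by linarith
  have hs : 0 < Real.sqrt v := Real.sqrt_pos.2 hv'
  set γ := ν + Real.sqrt v * x with hγ
  -- This J is large enough for 4^J to dominate e^J x³, yet 16^J stays below exp(x²/2) x³, so the
  -- last test fits in the horizon. The choice of t₀ gives σ√(t₀·16^j) ≥ 4^j/x.
  set J := ⌈x⌉₊ with hJ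
  set t₀ := ⌈1 / (x ^ 2 * (v : ℝ))⌉₊ with ht₀
  have ht₀1 : 1 ≤ t₀ := Nat.one_le_ceil_iff.2 (by positivity)
  have ht₀l : 1 / (x ^ 2 * (v : ℝ)) ≤ t₀ := Nat.le_ceil _
  have ht₀u : (t₀ : ℝ) ≤ 1 + 1 / (x ^ 2 * v) := by
    have := Nat.ceil_lt_add_one (show 0 ≤ 1 / (x ^ 2 * (v : ℝ)) by positivity)
    linarith
  have hlast : t₀ * 16 ^ J ≤ m := by
    have : (t₀ : ℝ) * 16 ^ J ≤ m := by
      refine le_trans ?_ h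
      calc (t₀ : ℝ) * 16 ^ J ≤ (1 + 1 / (x ^ 2 * v)) * (Real.exp (x ^ 2 / 2) * x ^ 3) := by
            gcongr
            exact sixteen_pow_ceil_le hx
        _ = 1 * (Real.exp (x ^ 2 / 2) * x ^ 3 * (1 + 1 / (x ^ 2 * v))) := by ring
        _ ≤ _ := by gcongr; norm_num
    exact_mod_cast this
  have ht : ∀ j ≤ J, 1 ≤ t₀ * 16 ^ j ∧ t₀ * 16 ^ j ≤ m := fun j hj =>
    ⟨Nat.one_le_iff_ne_zero.2 (by positivity), le_trans (by gcongr; norm_num) hlast⟩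
  have key := le_integral_reward_testRule (J := J) (t := fun j => t₀ * 16 ^ j)
    (E := fun j => failSet m (t₀ * 16 ^ j) γ (j + 2)) ν v γ ht
    (fun j => measurableSet_failSet_rewardFiltration m _ _ _)
    (fun j => measurableSet_failSet m _ _ _)
  have hmem := testRule_mem_stoppingTimes (J := J) (t := fun j => t₀ * 16 ^ j)
    (E := fun j => failSet m (t₀ * 16 ^ j) γ (j + 2)) ht
    (fun j => measurableSet_failSet_rewardFiltration m _ _ _)
  refine le_trans (le_trans ?_ key) (integral_reward_le_stoppingValue hmem γ)
  have hgain : Real.sqrt v * (1 / 60 * (Real.exp (-x ^ 2 / 2) / x ^ 2)) ≤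
      ∫ θ, max (θ - γ) 0 ∂(gaussianReal ν v) - ∑ j ∈ Finset.range (J + 1),
        ∫ θ, max (θ - γ) 0 * (rewardKernel m θ).real (failSet m (t₀ * 16 ^ j) γ (j + 2))
          ∂(gaussianReal ν v) := by
    have hG : ∫ θ, max (θ - γ) 0 ∂(gaussianReal ν v) = Real.sqrt v * expectedExcess x :=
      integral_max_sub_gaussianReal x
    have h1 : ∑ j ∈ Finset.range (J + 1), ∫ θ, max (θ - γ) 0 *
        (rewardKernel m θ).real (failSet m (t₀ * 16 ^ j) γ (j + 2)) ∂(gaussianReal ν v) ≤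
        1 / 2 * ∫ θ, max (θ - γ) 0 ∂(gaussianReal ν v) := by
      refine (Finset.sum_le_sum fun j hj => integral_excess_failSet_le
        (ht j (Nat.lt_succ_iff.1 (Finset.mem_range.1 hj))).2
        (ht j (Nat.lt_succ_iff.1 (Finset.mem_range.1 hj))).1 (by positivity)).trans ?_
      rw [← Finset.sum_mul]
      exact mul_le_mul_of_nonneg_right (sum_exp_neg_sq_le _)
        (integral_nonneg fun θ => le_max_right _ _)
    have h2 := le_expectedExcess (show 1 ≤ x by linarith)
    have h3 : 1 / 3 ≤ (Real.sqrt (2 * Real.pi))⁻¹ := by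
      rw [← one_div]
      refine one_div_le_one_div_of_le (by positivity) ?_
      refine Real.sqrt_le_iff.2 ⟨by norm_num, ?_⟩
      linarith [Real.pi_lt_d2]
    have h4 : 1 / 30 * (Real.exp (-x ^ 2 / 2) / x ^ 2) ≤ expectedExcess x := by
      refine le_trans ?_ h2
      calc 1 / 30 * (Real.exp (-x ^ 2 / 2) / x ^ 2) =
            1 / 3 * Real.exp (-x ^ 2 / 2) * (1 / 5) / (2 * x ^ 2) := by field_simp; norm_num
        _ ≤ _ := by
            gcongr
            exact exp_neg_three_halves_ge
    have h5 := mul_le_mul_of_nonneg_left h4 hs.le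
    rw [hG] at h1 ⊢
    linarith
  have hinit : ∫ θ, max (γ - θ) 0 ∂(gaussianReal ν v) ≤ Real.sqrt v * (3 * x) := by
    rw [hγ, integral_max_const_sub_gaussianReal]
    gcongr
    exact integral_shortfall_le (by linarith)
  have hearly : ∑ j ∈ Finset.range J, ((t₀ * 16 ^ (j + 1) : ℕ) : ℝ) *
      ∫ θ, max (γ - θ) 0 * (rewardKernel m θ).real (failSet m (t₀ * 16 ^ j) γ (j + 2))ᶜ
        ∂(gaussianReal ν v) ≤ Real.sqrt v * t₀ * x * 1099997 := by
    calc _ ≤ ∑ j ∈ Finset.range J, Real.sqrt v * t₀ * x * ((16 : ℝ) ^ (j + 1) *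
          (Real.exp ((j + 2 : ℝ) + 1 / 2) *
            (2 * (Real.exp (-(3 / 8 * 4 ^ j)) + Real.exp (-(3 / 8 * x ^ 2)))))) := by
          refine Finset.sum_le_sum fun j hj => ?_
          have hj' := ht j (Finset.mem_range.1 hj).le
          obtain ⟨L, hL⟩ : ∃ L, L = min ((4 : ℝ) ^ j / x) x := ⟨_, rfl⟩
          have hL0 : 0 < L := hL ▸ lt_min (by positivity) hx0
          have hLt : L ≤ Real.sqrt v * Real.sqrt ((t₀ * 16 ^ j : ℕ) : ℝ) := by
            push_cast
            exact (hL ▸ min_le_left _ _ : L ≤ 4 ^ j / x).trans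
              (four_pow_div_le_sqrt hx0 hv' ht₀l j)
          have h1 := integral_shortfall_compl_failSet_le (ν := ν) (x := x) hj'.2 hj'.1 hv
            (show (0 : ℝ) ≤ j + 2 by positivity) hL0.le hLt (half_pos hL0)
          have h2 := inv_mul_exp_min_le (show 1 ≤ x by linarith) j hL
          calc _ ≤ ((t₀ * 16 ^ (j + 1) : ℕ) : ℝ) * (Real.sqrt v *
                (Real.exp ((j + 2 : ℝ) + 1 / 2) * (x * (2 * (Real.exp (-(3 / 8 * 4 ^ j)) +
                  Real.exp (-(3 / 8 * x ^ 2))))))) := by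
                refine mul_le_mul_of_nonneg_left (h1.trans ?_) (Nat.cast_nonneg _)
                gcongr
            _ = _ := by push_cast; ring
      _ ≤ _ := by
          rw [← Finset.mul_sum]
          exact mul_le_mul_of_nonneg_left (sum_sixteen_pow_mul_exp_le hx) (by positivity)
  have hfinal : ∫ θ, max (γ - θ) 0 *
      (rewardKernel m θ).real (failSet m (t₀ * 16 ^ J) γ (J + 2))ᶜ ∂(gaussianReal ν v) ≤
      Real.sqrt v * (1 / 120 * (Real.exp (-x ^ 2 / 2) / x ^ 2)) := by
    -- After the last test L = 4^J/x, and k = L - x leaves the rate x: the exponent becomes exactly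
    -- -x²/2, matching the gain.
    have hk : 0 < (4 : ℝ) ^ J / x - x := by
      have h1 := le_four_pow_ceil hx
      rw [sub_pos, lt_div_iff₀ hx0]
      nlinarith
    have hLt : (4 : ℝ) ^ J / x ≤ Real.sqrt v * Real.sqrt ((t₀ * 16 ^ J : ℕ) : ℝ) := by
      push_cast
      exact four_pow_div_le_sqrt hx0 hv' ht₀l J
    have h1 := integral_shortfall_compl_failSet_le (ν := ν) (x := x) hlast (ht J le_rfl).1 hv
      (show (0 : ℝ) ≤ J + 2 by positivity) (by positivity) hLt hk
    refine h1.trans (mul_le_mul_of_nonneg_left ?_ hs.le)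
    have h2 : -((4 ^ J / x - (4 ^ J / x - x)) * x) + (4 ^ J / x - (4 ^ J / x - x)) ^ 2 / 2 =
        -x ^ 2 / 2 := by ring
    rw [h2, ← mul_assoc]
    calc _ ≤ 1 / 120 / x ^ 2 * Real.exp (-x ^ 2 / 2) := by
          gcongr
          exact exp_ceil_mul_inv_sub_le hx
      _ = _ := by ring
  -- 1100000 = 3 + 1099997 collects the initial and early losses; 1/120 = 1/60 - 1/120 is the gain
  -- left after the final loss.
  have hmain : 1100000 * ((t₀ : ℝ) * x) ≤ m * (1 / 120 * (Real.exp (-x ^ 2 / 2) / x ^ 2)) := by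
    have h1 : Real.exp (-x ^ 2 / 2) = (Real.exp (x ^ 2 / 2))⁻¹ := by
      rw [← Real.exp_neg]; ring_nf
    have he := Real.exp_pos (x ^ 2 / 2)
    have h2 : (m : ℝ) * (1 / 120 * (Real.exp (-x ^ 2 / 2) / x ^ 2)) =
        m / (120 * (Real.exp (x ^ 2 / 2) * x ^ 2)) := by
      rw [h1]; field_simp
    rw [h2, le_div_iff₀ (by positivity)]
    refine le_trans ?_ h
    have h3 : (t₀ : ℝ) * (Real.exp (x ^ 2 / 2) * x ^ 3) ≤
        (1 + 1 / (x ^ 2 * v)) * (Real.exp (x ^ 2 / 2) * x ^ 3) := by gcongr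
    have h4 : 0 ≤ (t₀ : ℝ) * (Real.exp (x ^ 2 / 2) * x ^ 3) := by positivity
    nlinarith
  have hm0 : (0 : ℝ) ≤ m := Nat.cast_nonneg m
  have e1 := mul_le_mul_of_nonneg_left hgain hm0
  have e2 := mul_le_mul_of_nonneg_left hinit (Nat.cast_nonneg t₀ : (0 : ℝ) ≤ t₀)
  have e3 := mul_le_mul_of_nonneg_left hfinal hm0
  have e4 := mul_le_mul_of_nonneg_left hmain hs.le
  simp only [pow_zero, mul_one] at *
  linarith

/-! ### From the index to the bounds on β -/

lemma one_le_logPlus (x : ℝ) : 1 ≤ logPlus x := le_max_left _ _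

lemma rpow_three_halves_eq {l : ℝ} (hl : 0 ≤ l) : l ^ (3 / 2 : ℝ) = Real.sqrt l ^ 3 := by
  rw [Real.sqrt_eq_rpow, ← Real.rpow_natCast, ← Real.rpow_mul hl]
  norm_num

lemma le_mul_sqrt_of_sq_le {y l : ℝ} (hl : 0 ≤ l) (h : y ^ 2 ≤ 2 * l) :
    y ≤ 1.42 * Real.sqrt l := by
  refine le_of_pow_le_pow_left₀ two_ne_zero (by positivity) ?_
  rw [mul_pow, Real.sq_sqrt hl]
  nlinarith

/-- The rate of growth of `exp (x² / 2)` for the normalised index `x`. -/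
noncomputable def rate (v : ℝ≥0) (m : ℕ) : ℝ :=
  min ((m : ℝ) / logPlus m ^ (3 / 2 : ℝ))
    ((m : ℝ) * (v : ℝ) / logPlus ((m : ℝ) * (v : ℝ)) ^ (1 / 2 : ℝ))

/-- Each entry of the minimum bounds y by 1.42 times the root of its own logarithm and thereby
controls one summand; the constants close as 2·10⁸ · (3 + 2) · 10⁻⁹ = 1. -/
lemma horizon_ge_of_exp_eq {v : ℝ≥0} (hv : 0 < v) {m : ℕ} {y : ℝ} (hy : 0 < y)
    (h : Real.exp (y ^ 2 / 2) = 10⁻¹ ^ 9 * rate v m) :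
    2 * 10 ^ 8 * (Real.exp (y ^ 2 / 2) * y ^ 3 * (1 + 1 / (y ^ 2 * v))) ≤ m := by
  have hv' : (0 : ℝ) < v := hv
  have hm0 : (0 : ℝ) ≤ m := Nat.cast_nonneg m
  have hl₁ := one_le_logPlus m
  have hl₂ := one_le_logPlus (m * v)
  set l₁ := logPlus m with hl₁'
  set l₂ := logPlus (m * v) with hl₂'
  have hs₁ : 1 ≤ Real.sqrt l₁ := Real.one_le_sqrt.2 hl₁
  have hs₂ : 1 ≤ Real.sqrt l₂ := Real.one_le_sqrt.2 hl₂
  have he₁ : Real.exp (y ^ 2 / 2) * Real.sqrt l₁ ^ 3 ≤ 10⁻¹ ^ 9 * m := by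
    have h1 : rate v m ≤ m / Real.sqrt l₁ ^ 3 := by
      rw [← rpow_three_halves_eq (by linarith)]
      exact min_le_left _ _
    rw [le_div_iff₀ (by positivity)] at h1
    rw [h]
    linarith
  have he₂ : Real.exp (y ^ 2 / 2) * Real.sqrt l₂ ≤ 10⁻¹ ^ 9 * (m * v) := by
    have h1 : rate v m ≤ m * v / Real.sqrt l₂ := by
      rw [Real.sqrt_eq_rpow]
      exact min_le_right _ _
    rw [le_div_iff₀ (by positivity)] at h1
    rw [h]
    linarith
  have hpos := Real.exp_pos (y ^ 2 / 2)
  have hy₁ : y ≤ 1.42 * Real.sqrt l₁ := by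
    have h1 : Real.exp (y ^ 2 / 2) ≤ m := by
      have := le_mul_of_one_le_right hpos.le (one_le_pow₀ hs₁ (n := 3))
      linarith
    have h2 := Real.log_le_log hpos h1
    rw [Real.log_exp] at h2
    have h3 : Real.log m ≤ l₁ := le_max_right _ _
    exact le_mul_sqrt_of_sq_le (by linarith) (by linarith)
  have hy₂ : y ≤ 1.42 * Real.sqrt l₂ := by
    have h1 : Real.exp (y ^ 2 / 2) ≤ m * v := by
      have := le_mul_of_one_le_right hpos.le hs₂
      have h0 : (0 : ℝ) ≤ m * v := by positivity
      linarith
    have h2 := Real.log_le_log hpos h1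
    rw [Real.log_exp] at h2
    have h3 : Real.log (m * v) ≤ l₂ := le_max_right _ _
    exact le_mul_sqrt_of_sq_le (by linarith) (by linarith)
  have e₁ : Real.exp (y ^ 2 / 2) * y ^ 3 ≤ 3 * (10⁻¹ ^ 9 * m) := by
    calc _ ≤ Real.exp (y ^ 2 / 2) * (1.42 * Real.sqrt l₁) ^ 3 := by gcongr
      _ = 1.42 ^ 3 * (Real.exp (y ^ 2 / 2) * Real.sqrt l₁ ^ 3) := by ring
      _ ≤ 1.42 ^ 3 * (10⁻¹ ^ 9 * m) := by gcongr
      _ ≤ _ := by gcongr; norm_num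
  have e₂ : Real.exp (y ^ 2 / 2) * y / v ≤ 2 * (10⁻¹ ^ 9 * m) := by
    rw [div_le_iff₀ hv']
    calc _ ≤ Real.exp (y ^ 2 / 2) * (1.42 * Real.sqrt l₂) := by gcongr
      _ = 1.42 * (Real.exp (y ^ 2 / 2) * Real.sqrt l₂) := by ring
      _ ≤ 1.42 * (10⁻¹ ^ 9 * (m * v)) := by gcongr
      _ ≤ 2 * (10⁻¹ ^ 9 * (m * v)) := by gcongr; norm_num
      _ = _ := by ring
  have e₃ : Real.exp (y ^ 2 / 2) * y ^ 3 * (1 + 1 / (y ^ 2 * v)) =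
      Real.exp (y ^ 2 / 2) * y ^ 3 + Real.exp (y ^ 2 / 2) * y / v := by
    field_simp
  rw [e₃]
  linarith

/-- The constant of the lower bound. -/
noncomputable def lowerConst : ℝ := 10⁻¹ ^ 9 * Real.exp (-(2500 ^ 2 / 2))

lemma lowerConst_pos : 0 < lowerConst := by unfold lowerConst; positivity

lemma rate_nonneg (v : ℝ≥0) (m : ℕ) : 0 ≤ rate v m := by
  have h1 := one_le_logPlus m
  have h2 := one_le_logPlus (m * v)
  exact le_min (by positivity) (by positivity)

/-- If 10⁻⁹ times the rate is below exp(2500²/2), the constant makes the left side at most 1.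
Otherwise the y with exp(y²/2) equal to it is at least 2500 and admissible, so y ≤ x. -/
lemma lowerConst_mul_rate_le_exp {ν : ℝ} {v : ℝ≥0} (hv : 0 < v) {m : ℕ} (hm : 1 ≤ m) {x : ℝ}
    (hx : gittinsIndex ν v m = ν + Real.sqrt v * x) :
    lowerConst * rate v m ≤ Real.exp (x ^ 2 / 2) := by
  have hs : 0 < Real.sqrt v := Real.sqrt_pos.2 hv
  have hr := rate_nonneg v m
  set r := 10⁻¹ ^ 9 * rate v m with hrdef
  have hr0 : 0 ≤ r := by positivity
  have hc : lowerConst * rate v m = r * Real.exp (-(2500 ^ 2 / 2)) := by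
    rw [hrdef, lowerConst]; ring
  rw [hc]
  rcases le_total r (Real.exp (2500 ^ 2 / 2)) with h | h
  · calc r * Real.exp (-(2500 ^ 2 / 2)) ≤
          Real.exp (2500 ^ 2 / 2) * Real.exp (-(2500 ^ 2 / 2)) := by gcongr
      _ = 1 := by rw [← Real.exp_add, add_neg_cancel, Real.exp_zero]
      _ ≤ _ := Real.one_le_exp (by positivity)
  · have hrpos : 0 < r := lt_of_lt_of_le (Real.exp_pos _) h
    have hlog : 2500 ^ 2 / 2 ≤ Real.log r := (Real.le_log_iff_exp_le hrpos).2 h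
    set y := Real.sqrt (2 * Real.log r) with hy
    have hy2 : y ^ 2 / 2 = Real.log r := by
      rw [hy, Real.sq_sqrt (by linarith)]; ring
    have hexp : Real.exp (y ^ 2 / 2) = r := by rw [hy2, Real.exp_log hrpos]
    have hy' : 2500 ≤ y := Real.le_sqrt_of_sq_le (by linarith)
    have hmem := mem_indexSet_of_horizon_ge ν hv hy'
      (horizon_ge_of_exp_eq hv (by linarith) hexp)
    have hle := (isGreatest_gittinsIndex hm).2 hmem
    rw [hx] at hle
    have hyx : y ≤ x := le_of_mul_le_mul_left (by linarith) hs
    calc r * Real.exp (-(2500 ^ 2 / 2)) ≤ r * 1 := by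
          gcongr
          exact Real.exp_le_one_iff.2 (by norm_num)
      _ = Real.exp (y ^ 2 / 2) := by rw [hexp, mul_one]
      _ ≤ _ := by gcongr

lemma betaBounds_exp {ν : ℝ} {v : ℝ≥0} (hv : 0 < v) {m : ℕ} (hm : 1 ≤ m) {x : ℝ} (hx0 : 0 ≤ x)
    (hx : gittinsIndex ν v m = ν + Real.sqrt v * x) :
    BetaBounds lowerConst v m (Real.exp (x ^ 2 / 2)) := by
  refine ⟨lowerConst_mul_rate_le_exp hv hm hx, fun hm2 => ?_⟩
  rcases hx0.eq_or_lt with rfl | hx0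
  · simpa using one_le_div_log_rpow hm2
  · exact exp_le_div_log_rpow hm2 hx0
      (cube_mul_exp_le_of_mem_indexSet hm hv hx0 (hx ▸ (isGreatest_gittinsIndex hm).1))

lemma gittinsIndex_zero {ν : ℝ} {m : ℕ} (hm : 1 ≤ m) : gittinsIndex ν 0 m = ν :=
  le_antisymm (le_of_mem_indexSet_zero hm (isGreatest_gittinsIndex hm).1) (le_gittinsIndex hm)

lemma betaBounds_of_eq {ν : ℝ} {v : ℝ≥0} (hv : 0 < v) {m : ℕ} (hm : 1 ≤ m) {β : ℝ} (hβ : 1 ≤ β)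
    (h : gittinsIndex ν v m = ν + Real.sqrt (2 * (v : ℝ) * Real.log β)) :
    BetaBounds lowerConst v m β := by
  have hlog : 0 ≤ Real.log β := Real.log_nonneg hβ
  have hb : Real.exp (Real.sqrt (2 * Real.log β) ^ 2 / 2) = β := by
    rw [Real.sq_sqrt (by positivity), mul_div_cancel_left₀ _ two_ne_zero,
      Real.exp_log (by linarith)]
  rw [← hb]
  refine betaBounds_exp (ν := ν) hv hm (Real.sqrt_nonneg _) ?_
  rw [h, ← Real.sqrt_mul v.coe_nonneg]
  ring_nf

lemma exists_betaBounds (ν : ℝ) (v : ℝ≥0) {m : ℕ} (hm : 1 ≤ m) :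
    ∃ β : ℝ, 1 ≤ β ∧ gittinsIndex ν v m = ν + Real.sqrt (2 * (v : ℝ) * Real.log β) ∧
      BetaBounds lowerConst v m β := by
  rcases eq_or_lt_of_le (zero_le : 0 ≤ v) with rfl | hv
  -- For zero variance β is arbitrary; β = 1 works since the rate vanishes.
  · refine ⟨1, le_rfl, by simp [gittinsIndex_zero hm], ?_, fun hm2 => one_le_div_log_rpow hm2⟩
    have : (0 : ℝ) ≤ (m : ℝ) / logPlus m ^ (3 / 2 : ℝ) := by
      have := one_le_logPlus m
      positivity
    simp [this]
  · have hs : 0 < Real.sqrt v := Real.sqrt_pos.2 hv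
    obtain ⟨x, hx⟩ : ∃ x, gittinsIndex ν v m = ν + Real.sqrt v * x :=
      ⟨(gittinsIndex ν v m - ν) / Real.sqrt v, by field_simp; ring⟩
    have hx0 : 0 ≤ x := by
      have := le_gittinsIndex (ν := ν) (v := v) hm
      exact nonneg_of_mul_nonneg_right (a := Real.sqrt v) (by linarith) hs
    refine ⟨Real.exp (x ^ 2 / 2), Real.one_le_exp (by positivity), ?_, betaBounds_exp hv hm hx0 hx⟩
    rw [hx, Real.log_exp, show 2 * (v : ℝ) * (x ^ 2 / 2) = v * x ^ 2 by ring,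
      Real.sqrt_mul v.coe_nonneg, Real.sqrt_sq hx0]

/-- The quantity of the asymptotic statement satisfies the bounds on `β`. -/
lemma betaBounds_exp_normalised (ν : ℝ) {v : ℝ≥0} (hv : 0 < v) {m : ℕ} (hm : 1 ≤ m) :
    BetaBounds lowerConst v m
      (Real.exp (((gittinsIndex ν v m - ν) / Real.sqrt (2 * (v : ℝ))) ^ 2)) := by
  have hv' : (0 : ℝ) < v := hv
  obtain ⟨β, hβ, h, hb⟩ := exists_betaBounds ν v hm
  have hlog : 0 ≤ Real.log β := Real.log_nonneg hβ
  have : ((gittinsIndex ν v m - ν) / Real.sqrt (2 * (v : ℝ))) ^ 2 = Real.log β := by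
    rw [h, add_sub_cancel_left, div_pow, Real.sq_sqrt (by positivity),
      Real.sq_sqrt (by positivity), mul_div_cancel_left₀ _ (by positivity)]
  rwa [this, Real.exp_log (by linarith)]

/-! ### Asymptotics for fixed variance -/

lemma min_mul_le_rate {v : ℝ≥0} (hv : 0 < v) {m : ℕ} (h1 : 1 ≤ Real.log m)
    (hvm : (v : ℝ) ≤ m) :
    min 1 ((v : ℝ) / 2) * ((m : ℝ) / Real.log m ^ (3 / 2 : ℝ)) ≤ rate v m := by
  have hv' : (0 : ℝ) < v := hv
  have hm : (0 : ℝ) < m := lt_of_lt_of_le hv' hvm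
  have hD : 0 ≤ (m : ℝ) / Real.log m ^ (3 / 2 : ℝ) := by positivity
  refine le_min ?_ ?_
  · rw [logPlus, max_eq_right h1]
    exact mul_le_of_le_one_left hD (min_le_left _ _)
  · refine (mul_le_mul_of_nonneg_right (min_le_right _ _) hD).trans ?_
    -- Since v ≤ m, log(mv) ≤ 2 log m, so the second entry of the minimum loses only a root of the
    -- logarithm.
    have hl : logPlus (m * v) ≤ 2 * Real.log m := by
      refine max_le (by linarith) ?_
      rw [Real.log_mul hm.ne' hv'.ne']
      linarith [Real.log_le_log hv' hvm]
    have h2 := one_le_logPlus (m * v)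
    have h3 : logPlus (m * v) ^ (1 / 2 : ℝ) ≤ 2 * Real.log m ^ (3 / 2 : ℝ) := by
      rw [← Real.sqrt_eq_rpow, rpow_three_halves_eq (by linarith)]
      have hs : 1 ≤ Real.sqrt (Real.log m) := Real.one_le_sqrt.2 h1
      refine (Real.sqrt_le_sqrt hl).trans (Real.sqrt_le_iff.2 ⟨by positivity, ?_⟩)
      calc 2 * Real.log m = 2 * (Real.sqrt (Real.log m) ^ 2 * 1) := by
            rw [Real.sq_sqrt (by linarith), mul_one]
        _ ≤ 4 * (Real.sqrt (Real.log m) ^ 2 * Real.sqrt (Real.log m) ^ 4) := by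
            gcongr
            · norm_num
            · exact one_le_pow₀ hs
        _ = _ := by ring
    rw [div_mul_div_comm, mul_comm (v : ℝ)]
    gcongr

theorem isTheta_exp_normalised (ν : ℝ) {v : ℝ≥0} (hv : 0 < v) :
    (fun m : ℕ => Real.exp (((gittinsIndex ν v m - ν) / Real.sqrt (2 * (v : ℝ))) ^ 2))
      =Θ[atTop] (fun m : ℕ => (m : ℝ) / Real.log m ^ (3 / 2 : ℝ)) := by
  have hv' : (0 : ℝ) < v := hv
  have hk : 0 < lowerConst * min 1 ((v : ℝ) / 2) :=
    mul_pos lowerConst_pos (lt_min one_pos (by positivity))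
  have hlog : ∀ᶠ m : ℕ in atTop, 1 ≤ Real.log m :=
    (Real.tendsto_log_atTop.comp tendsto_natCast_atTop_atTop).eventually_ge_atTop 1
  have hvm : ∀ᶠ m : ℕ in atTop, (v : ℝ) ≤ m :=
    tendsto_natCast_atTop_atTop.eventually_ge_atTop (v : ℝ)
  constructor
  · refine IsBigO.of_bound 1 ?_
    filter_upwards [hlog, eventually_ge_atTop 2] with m h1 h2
    rw [Real.norm_of_nonneg (Real.exp_pos _).le, Real.norm_of_nonneg (by positivity), one_mul]
    exact (betaBounds_exp_normalised ν hv (by lia)).2 h2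
  · refine IsBigO.of_bound (lowerConst * min 1 ((v : ℝ) / 2))⁻¹ ?_
    filter_upwards [hlog, hvm, eventually_ge_atTop 1] with m h1 h2 h3
    rw [Real.norm_of_nonneg (Real.exp_pos _).le, Real.norm_of_nonneg (by positivity),
      le_inv_mul_iff₀ hk, mul_assoc]
    exact (mul_le_mul_of_nonneg_left (min_mul_le_rate hv h1 h2) lowerConst_pos.le).trans
      (betaBounds_exp_normalised ν hv h3).1

end Gittins

theorem theorem1 :
    (∃ c : ℝ, 0 < c ∧ ∀ (ν : ℝ) (v : ℝ≥0) (m : ℕ), 1 ≤ m →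
      -- the maximum that defines the index is attained
      IsGreatest (Gittins.indexSet ν v m) (Gittins.gittinsIndex ν v m) ∧
      -- the index can be written with some `β ≥ 1` that satisfies the bounds
      (∃ β : ℝ, 1 ≤ β ∧
        Gittins.gittinsIndex ν v m = ν + Real.sqrt (2 * (v : ℝ) * Real.log β) ∧
        Gittins.BetaBounds c v m β) ∧
      -- if the variance is positive, every such `β` satisfies them
      (0 < v → ∀ β : ℝ, 1 ≤ β →
        Gittins.gittinsIndex ν v m = ν + Real.sqrt (2 * (v : ℝ) * Real.log β) →
        Gittins.BetaBounds c v m β)) ∧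
    (∀ (ν : ℝ) (v : ℝ≥0), 0 < v →
      (fun m : ℕ =>
          Real.exp (((Gittins.gittinsIndex ν v m - ν) / Real.sqrt (2 * (v : ℝ))) ^ 2))
        =Θ[atTop] (fun m : ℕ => (m : ℝ) / Real.log m ^ (3 / 2 : ℝ))) := by
  refine ⟨⟨Gittins.lowerConst, Gittins.lowerConst_pos, fun ν v m hm =>
    ⟨Gittins.isGreatest_gittinsIndex hm, Gittins.exists_betaBounds ν v hm, fun hv β hβ h =>
      Gittins.betaBounds_of_eq hv hm hβ h⟩⟩, fun ν v hv => Gittins.isTheta_exp_normalised ν hv⟩
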